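/- Let $\mathfrak g$ be a finite-dimensional simple Lie algebra over $\mathbf C$ with a symmetric, invariant, nondegenerate bilinear form $(\cdot\mid\cdot)$, and let $f_1,f_2\in\mathfrak g$ be nilpotent. For $i=1,2$ let $\chi_i=(f_i\mid\cdot)\in\mathfrak g^*$ and let $\Gamma^i:\mathfrak g=\bigoplus_{j\in\mathbf Z}\mathfrak g^{(i)}_j$ be a good grading for $f_i$, that is, a Lie algebra grading with $f_i\in\mathfrak g^{(i)}_{-2}$ such that $\operatorname{ad}(f_i):\mathfrak g^{(i)}_j\to\mathfrak g^{(i)}_{j-2}$ is injective for $j\ge 1$ and surjective for $j\le 1$. Let $q_i\in\mathfrak g$ be the semisimple element with $\mathfrak g^{(i)}_j=\{x\in\mathfrak g : [q_i,x]=jx\}$ for all $j$, and assume that $q_1,q_2$ lie in a common Cartan subalgebra $\mathfrak h$. Let $\mathfrak m_i=\mathfrak l_i\oplus\bigoplus_{j\ge 2}\mathfrak g^{(i)}_j$, where $\mathfrak l_i$ is a Lagrangian subspace of $\mathfrak g^{(i)}_1$ for the symplectic form $\chi_i([\cdot,\cdot])$; this is a Lie subalgebra of which $\chi_i$ is a character.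 Let $\widehat{I_i}$ be the left ideal of $\mathcal U(\mathfrak g)$ generated by the elements $y-\chi_i(y)$, $y\in\mathfrak m_i$. The finite W-algebra of $f_i$ is $$\mathcal U(\mathfrak g,f_i)=\bigl(\mathcal U(\mathfrak g)/\widehat{I_i}\bigr)^{\operatorname{ad}(\mathfrak m_i)}=\{X \bmod \widehat{I_i} : [y,X]\in\widehat{I_i}\ \text{for all } y\in\mathfrak m_i\},$$ with the product induced by that of $\mathcal U(\mathfrak g)$. Assume that: 1. $\mathfrak m_2=\mathfrak m_1\oplus\mathfrak m_0$ as vector spaces, where $\mathfrak m_0$ is an $\mathfrak h$-stable Lie subalgebra of $\mathfrak m_2$ and $\mathfrak m_1$ is an ideal of $\mathfrak m_2$; 2. $f_0:=f_2-f_1$ and $\mathfrak m_0$ are contained in $\mathfrak g^{(1)}_0$; 3. $q_0:=q_2-q_1$ commutes with $f_1$. Then the map $\mathfrak m_0\to\mathcal U(\mathfrak g,f_1)$, $y\mapsto y\bmod\widehat{I_1}$, is a well-defined injective homomorphism of Lie algebras. Let $\widehat{I_0}$ be the left ideal of $\mathcal U(\mathfrak g,f_1)$ generated by the elements $(y-\chi_2(y))\bmod\widehat{I_1}$,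 $y\in\mathfrak m_0$, and let $$\mathcal U_0=\bigl(\mathcal U(\mathfrak g,f_1)/\widehat{I_0}\bigr)^{\operatorname{ad}(\mathfrak m_0)},$$ with the product induced by that of $\mathcal U(\mathfrak g,f_1)$; this is the quantum Hamiltonian reduction of $\mathcal U(\mathfrak g,f_1)$ by $\mathfrak m_0$. Then the map $$\widehat\Psi:\mathcal U_0\longrightarrow\mathcal U(\mathfrak g,f_2),\qquad (X\bmod\widehat{I_1})\bmod\widehat{I_0}\longmapsto X\bmod\widehat{I_2},$$ is a well-defined isomorphism of $\mathbf C$-algebras. -/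

import Mathlib

attribute [local instance 100] LieRing.ofAssociativeRing

noncomputable section

/-! ### Quantum Hamiltonian reduction

Data: an associative unital `ℂ`-algebra `A`, a Lie algebra `𝔪`, a Lie algebra homomorphism
`φ : 𝔪 → A` (for the commutator bracket of `A`) and a linear form `χ` on `𝔪`. -/

namespace QuantumReduction

variable {A : Type*} [Ring A] [Algebra ℂ A] {𝔪 : Type*} [LieRing 𝔪] [LieAlgebra ℂ 𝔪]
  (φ : 𝔪 →ₗ⁅ℂ⁆ A) (χ : 𝔪 →ₗ[ℂ] ℂ)

/-- The left ideal of `A` generated by the elements `φ y - χ y`, `y ∈ 𝔪`. -/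
def leftIdeal : Ideal A :=
  Ideal.span (Set.range fun y : 𝔪 => φ y - algebraMap ℂ A (χ y))

/-- The left `A`-module `Q = A / leftIdeal`. -/
abbrev Q : Type _ := A ⧸ leftIdeal φ χ

/-- The class `X mod leftIdeal` in `Q`. -/
abbrev toQ (X : A) : Q φ χ := Submodule.Quotient.mk X

variable {φ χ}

theorem gen_mem (y : 𝔪) : φ y - algebraMap ℂ A (χ y) ∈ leftIdeal φ χ :=
  Ideal.subset_span ⟨y, rfl⟩

/-- Modulo the left ideal, `[φ y, X]` equals `(φ y - χ y) X`. -/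
theorem lie_mem_iff (y : 𝔪) (X : A) :
    ⁅φ y, X⁆ ∈ leftIdeal φ χ ↔ (φ y - algebraMap ℂ A (χ y)) * X ∈ leftIdeal φ χ := by
  have h : (φ y - algebraMap ℂ A (χ y)) * X
      = ⁅φ y, X⁆ + X * (φ y - algebraMap ℂ A (χ y)) := by
    rw [LieRing.of_associative_ring_bracket, sub_mul, mul_sub, Algebra.commutes (χ y) X]
    abel
  rw [h]
  exact (Submodule.add_mem_iff_left _
    (Submodule.smul_mem (leftIdeal φ χ) X (gen_mem y))).symm

variable (φ χ)

/-- The subspace `Q^{ad 𝔪}`: all classes `X mod leftIdeal` such that `[φ y, X]` lies in the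
left ideal for all `y ∈ 𝔪`. -/
def invariants : Submodule ℂ (Q φ χ) where
  carrier := {q | ∃ X : A, toQ φ χ X = q ∧ ∀ y : 𝔪, ⁅φ y, X⁆ ∈ leftIdeal φ χ}
  zero_mem' := ⟨0, rfl, fun y => by simp⟩
  add_mem' := by
    rintro _ _ ⟨X, rfl, hX⟩ ⟨Y, rfl, hY⟩
    exact ⟨X + Y, rfl, fun y => by rw [lie_add]; exact add_mem (hX y) (hY y)⟩
  smul_mem' := by
    rintro c _ ⟨X, rfl, hX⟩
    refine ⟨c • X, rfl, fun y => ?_⟩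
    rw [lie_smul, ← algebraMap_smul A c]
    exact Submodule.smul_mem _ _ (hX y)

variable {φ χ}

/-- The invariance condition does not depend on the representative. -/
theorem toQ_mem_invariants_iff (X : A) :
    toQ φ χ X ∈ invariants φ χ ↔ ∀ y : 𝔪, ⁅φ y, X⁆ ∈ leftIdeal φ χ := by
  refine ⟨?_, fun h => ⟨X, rfl, h⟩⟩
  rintro ⟨Y, hYX, hY⟩ y
  have hd : Y - X ∈ leftIdeal φ χ := (Submodule.Quotient.eq _).1 hYX
  rw [lie_mem_iff]
  have h1 := (lie_mem_iff y Y).1 (hY y)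
  have h2 := Submodule.smul_mem (leftIdeal φ χ) (φ y - algebraMap ℂ A (χ y)) hd
  rw [smul_eq_mul, mul_sub] at h2
  exact (Submodule.sub_mem_iff_right _ h1).1 h2

/-- For an invariant class `b`, the map `X mod leftIdeal ↦ X • b` of `Q` to itself. -/
def rightMul (b : invariants φ χ) : Q φ χ →ₗ[A] Q φ χ :=
  Submodule.liftQ (leftIdeal φ χ) (LinearMap.toSpanSingleton A (Q φ χ) (b : Q φ χ)) (by
    obtain ⟨_, Y, rfl, hY⟩ := b
    refine Submodule.span_le.2 ?_
    rintro _ ⟨y, rfl⟩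
    exact (Submodule.Quotient.mk_eq_zero _).2 ((lie_mem_iff y Y).1 (hY y)))

theorem rightMul_toQ (X Y : A) (hY : toQ φ χ Y ∈ invariants φ χ) :
    rightMul ⟨toQ φ χ Y, hY⟩ (toQ φ χ X) = toQ φ χ (X * Y) := rfl

theorem toQ_mul_mem {X Y : A} (hX : toQ φ χ X ∈ invariants φ χ)
    (hY : toQ φ χ Y ∈ invariants φ χ) : toQ φ χ (X * Y) ∈ invariants φ χ := by
  rw [toQ_mem_invariants_iff] at *
  intro y
  have h1 : ⁅φ y, X⁆ * Y ∈ leftIdeal φ χ := by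
    have h := rightMul_toQ ⁅φ y, X⁆ Y ((toQ_mem_invariants_iff Y).2 hY)
    have h0 : toQ φ χ ⁅φ y, X⁆ = 0 := (Submodule.Quotient.mk_eq_zero _).2 (hX y)
    rw [h0, map_zero] at h
    exact (Submodule.Quotient.mk_eq_zero _).1 h.symm
  have h2 : ⁅φ y, X * Y⁆ = ⁅φ y, X⁆ * Y + X * ⁅φ y, Y⁆ := by
    simp only [LieRing.of_associative_ring_bracket]
    noncomm_ring
  rw [h2]
  exact add_mem h1 (Submodule.smul_mem (leftIdeal φ χ) X (hY y))

instance : Mul (invariants φ χ) where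
  mul a b := ⟨rightMul b a, by
    obtain ⟨_, X, rfl, hX⟩ := a
    obtain ⟨_, Y, rfl, hY⟩ := b
    exact toQ_mul_mem ⟨X, rfl, hX⟩ ⟨Y, rfl, hY⟩⟩

instance : One (invariants φ χ) where
  one := ⟨toQ φ χ 1, 1, rfl, fun y => by simp [LieRing.of_associative_ring_bracket]⟩

/-- The product of `Q^{ad 𝔪}` is induced by that of `A`. -/
theorem mk_mul_mk {X Y : A} (hX : toQ φ χ X ∈ invariants φ χ)
    (hY : toQ φ χ Y ∈ invariants φ χ) :
    (⟨toQ φ χ X, hX⟩ * ⟨toQ φ χ Y, hY⟩ : invariants φ χ)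
      = ⟨toQ φ χ (X * Y), toQ_mul_mem hX hY⟩ := rfl

theorem one_def : (1 : invariants φ χ) = ⟨toQ φ χ 1, (1 : invariants φ χ).2⟩ := rfl

theorem exists_rep (a : invariants φ χ) :
    ∃ (X : A) (hX : toQ φ χ X ∈ invariants φ χ), a = ⟨toQ φ χ X, hX⟩ := by
  obtain ⟨_, X, rfl, hX⟩ := a
  exact ⟨X, _, rfl⟩

instance : Ring (invariants φ χ) where
  __ := (inferInstance : AddCommGroup (invariants φ χ))
  __ := (inferInstance : Mul (invariants φ χ))
  __ := (inferInstance : One (invariants φ χ))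
  left_distrib a b c := by
    obtain ⟨X, hX, rfl⟩ := exists_rep a
    obtain ⟨Y, hY, rfl⟩ := exists_rep b
    obtain ⟨Z, hZ, rfl⟩ := exists_rep c
    exact Subtype.ext (congrArg (toQ φ χ) (mul_add X Y Z))
  right_distrib a b c := by
    obtain ⟨X, hX, rfl⟩ := exists_rep a
    obtain ⟨Y, hY, rfl⟩ := exists_rep b
    obtain ⟨Z, hZ, rfl⟩ := exists_rep c
    exact Subtype.ext (congrArg (toQ φ χ) (add_mul X Y Z))
  zero_mul a := by
    obtain ⟨X, hX, rfl⟩ := exists_rep a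
    exact Subtype.ext (congrArg (toQ φ χ) (zero_mul X))
  mul_zero a := by
    obtain ⟨X, hX, rfl⟩ := exists_rep a
    exact Subtype.ext (congrArg (toQ φ χ) (mul_zero X))
  mul_assoc a b c := by
    obtain ⟨X, hX, rfl⟩ := exists_rep a
    obtain ⟨Y, hY, rfl⟩ := exists_rep b
    obtain ⟨Z, hZ, rfl⟩ := exists_rep c
    exact Subtype.ext (congrArg (toQ φ χ) (mul_assoc X Y Z))
  one_mul a := by
    obtain ⟨X, hX, rfl⟩ := exists_rep a
    exact Subtype.ext (congrArg (toQ φ χ) (one_mul X))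
  mul_one a := by
    obtain ⟨X, hX, rfl⟩ := exists_rep a
    exact Subtype.ext (congrArg (toQ φ χ) (mul_one X))

instance : Algebra ℂ (invariants φ χ) :=
  Algebra.ofModule
    (fun c a b => by
      obtain ⟨X, hX, rfl⟩ := exists_rep a
      obtain ⟨Y, hY, rfl⟩ := exists_rep b
      exact Subtype.ext (congrArg (toQ φ χ) (smul_mul_assoc c X Y)))
    (fun c a b => by
      obtain ⟨X, hX, rfl⟩ := exists_rep a
      obtain ⟨Y, hY, rfl⟩ := exists_rep b
      exact Subtype.ext (congrArg (toQ φ χ) (mul_smul_comm c X Y)))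

end QuantumReduction

/-! ### Good gradings, good algebras and finite W-algebras -/

namespace FiniteW

variable {𝔤 : Type*} [LieRing 𝔤] [LieAlgebra ℂ 𝔤]

/-- `Γ` is a `ℤ`-grading of the Lie algebra `𝔤` that is good for `f`. -/
structure IsGoodGrading (Γ : ℤ → Submodule ℂ 𝔤) (f : 𝔤) : Prop where
  isInternal : DirectSum.IsInternal Γ
  lie_mem : ∀ i j : ℤ, ∀ x ∈ Γ i, ∀ y ∈ Γ j, ⁅x, y⁆ ∈ Γ (i + j)
  mem_neg_two : f ∈ Γ (-2)
  injective : ∀ j : ℤ, 1 ≤ j → ∀ x ∈ Γ j, ⁅f, x⁆ = 0 → x = 0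
  surjective : ∀ j : ℤ, j ≤ 1 → ∀ y ∈ Γ (j - 2), ∃ x ∈ Γ j, ⁅f, x⁆ = y

/-- `q` is the element of `𝔤` defining the grading `Γ`: the homogeneous component of degree `j`
is the eigenspace of `ad q` for the eigenvalue `j`. -/
def IsGradingElement (Γ : ℤ → Submodule ℂ 𝔤) (q : 𝔤) : Prop :=
  ∀ (j : ℤ) (x : 𝔤), x ∈ Γ j ↔ ⁅q, x⁆ = (j : ℂ) • x

/-- The linear form `χ = (f | ·)` on `𝔤`. -/
abbrev chi (B : LinearMap.BilinForm ℂ 𝔤) (f : 𝔤) : 𝔤 →ₗ[ℂ] ℂ := B f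

/-- `𝔩` is a Lagrangian subspace of the symplectic space `Γ 1` with the form `χ([·,·])`: it is
equal to its own orthogonal in `Γ 1`. -/
def IsLagrangian (B : LinearMap.BilinForm ℂ 𝔤) (Γ : ℤ → Submodule ℂ 𝔤) (f : 𝔤)
    (𝔩 : Submodule ℂ 𝔤) : Prop :=
  ∀ x : 𝔤, x ∈ 𝔩 ↔ x ∈ Γ 1 ∧ ∀ y ∈ 𝔩, chi B f ⁅x, y⁆ = 0

/-- `𝔪` is a good algebra for `Γ` and `f`: it is `𝔩 ⊕ ⨁_{i ≥ 2} Γ i` for some Lagrangian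
subspace `𝔩` of `Γ 1`. -/
def IsGoodAlgebra (B : LinearMap.BilinForm ℂ 𝔤) (Γ : ℤ → Submodule ℂ 𝔤) (f : 𝔤)
    (𝔪 : LieSubalgebra ℂ 𝔤) : Prop :=
  ∃ 𝔩 : Submodule ℂ 𝔤, IsLagrangian B Γ f 𝔩 ∧
    𝔪.toSubmodule = 𝔩 ⊔ ⨆ (i : ℤ) (_ : 2 ≤ i), Γ i

/-- The Lie algebra homomorphism `𝔪 → 𝔤 → U(𝔤)`. -/
abbrev toU (𝔪 : LieSubalgebra ℂ 𝔤) : 𝔪 →ₗ⁅ℂ⁆ UniversalEnvelopingAlgebra ℂ 𝔤 :=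
  (UniversalEnvelopingAlgebra.ι ℂ).comp 𝔪.incl

/-- The restriction of `χ = (f | ·)` to `𝔪`. -/
abbrev chiOn (B : LinearMap.BilinForm ℂ 𝔤) (f : 𝔤) (𝔪 : LieSubalgebra ℂ 𝔤) : 𝔪 →ₗ[ℂ] ℂ :=
  (chi B f).comp 𝔪.toSubmodule.subtype

/-- The generalized Gelfand-Graev module `U(𝔤) / Î`, where `Î` is the left ideal generated by
`y - χ(y)`, `y ∈ 𝔪`. -/
abbrev GelfandGraev (B : LinearMap.BilinForm ℂ 𝔤) (f : 𝔤) (𝔪 : LieSubalgebra ℂ 𝔤) : Type _ :=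
  QuantumReduction.Q (toU 𝔪) (chiOn B f 𝔪)

/-- The class `X mod Î`. -/
abbrev toGG (B : LinearMap.BilinForm ℂ 𝔤) (f : 𝔤) (𝔪 : LieSubalgebra ℂ 𝔤)
    (X : UniversalEnvelopingAlgebra ℂ 𝔤) : GelfandGraev B f 𝔪 :=
  QuantumReduction.toQ (toU 𝔪) (chiOn B f 𝔪) X

/-- The finite W-algebra `U(𝔤, f) = (U(𝔤) / Î)^{ad 𝔪}`. -/
abbrev WAlgebra (B : LinearMap.BilinForm ℂ 𝔤) (f : 𝔤) (𝔪 : LieSubalgebra ℂ 𝔤) :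
    Submodule ℂ (GelfandGraev B f 𝔪) :=
  QuantumReduction.invariants (toU 𝔪) (chiOn B f 𝔪)

end FiniteW

end

/-!
Let `x k`, `z k` be a homogeneous basis `z` of `𝔪₁` with a dual family `x` for the pairing
`χ₁ ⁅·, ·⁆`. The Euler operator `E = ∑ k, (x k - χ₁ (x k)) (z k - χ₁ (z k))` lies in `Î₁`, so it
annihilates every invariant class. On the other hand it acts on the subquotients of a filtration of
`U(𝔤) / Î₁`, indexed by pairs `(p, l)` of a degree and a number of factors, by the integer `l`.
Hence a product of factors `1 - E / l` turns any given class into an invariant one, without moving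
the classes that are already invariant. For any `X`, this produces a polynomial `P` with
`P(0) = 1` and `P(E) X` invariant modulo `Î₁`; as `E ∈ Î₁ ⊆ Î₂`, such modifications lift invariants
of `U(𝔤) / Î₂` to the first stage and show that `Î₂` and `Î₀` cut out the same ideal there.

Injectivity on `𝔪₀` says that `Î₁` meets `𝔤` inside `𝔪₁`. It follows from the linear independence of
ordered monomials in `U(𝔤)`, which is read off from the action on polynomial functions on matrices
given by a faithful finite-dimensional representation.
-/

/-! ### Words in a family of elements of an algebra -/

noncomputable section

section Words

variable {K A κ : Type*} [Field K] [Ring A] [Algebra K A]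

/-- The monomial `g i₁ * ⋯ * g iₙ` attached to a list `[i₁, …, iₙ]` of letters. -/
def word (g : κ → A) (l : List κ) : A := (l.map g).prod

@[simp] theorem word_nil (g : κ → A) : word g [] = 1 := rfl

@[simp] theorem word_cons (g : κ → A) (i : κ) (l : List κ) :
    word g (i :: l) = g i * word g l := by
  simp [word]

@[simp] theorem word_append (g : κ → A) (l l' : List κ) :
    word g (l ++ l') = word g l * word g l' := by
  simp [word]

theorem word_map {κ' : Type*} (g : κ → A) (f : κ' → κ) (l : List κ') :
    word g (l.map f) = word (g ∘ f) l := by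
  simp [word]

theorem map_word {A' F : Type*} [Ring A'] [FunLike F A A'] [RingHomClass F A A'] (φ : F)
    (g : κ → A) (l : List κ) : φ (word g l) = word (φ ∘ g) l := by
  simp [word, map_list_prod]

theorem span_range_word_eq_top {g : κ → A} (hg : Algebra.adjoin K (Set.range g) = ⊤) :
    Submodule.span K (Set.range (word g)) = ⊤ := by
  rw [← Algebra.top_toSubmodule, ← hg, Algebra.adjoin_eq_span]
  rw [← FreeMonoid.mrange_lift, MonoidHom.coe_mrange]
  exact congrArg _ (congrArg Set.range (funext fun l => (FreeMonoid.lift_apply g l).symm))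

/-- The span of the monomials of length at least `n` and less than `m`. -/
def wordSpan (K : Type*) [Field K] [Algebra K A] (g : κ → A) (n m : ℕ) : Submodule K A :=
  Submodule.span K (word g '' {l | n ≤ l.length ∧ l.length < m})

theorem word_mem_wordSpan {g : κ → A} {n m : ℕ} {l : List κ} (h : n ≤ l.length)
    (h' : l.length < m) : word g l ∈ wordSpan K g n m :=
  Submodule.subset_span ⟨l, ⟨h, h'⟩, rfl⟩

theorem self_mem_wordSpan (g : κ → A) {n m : ℕ} (hn : n ≤ 1) (hm : 1 < m) (i : κ) :
    g i ∈ wordSpan K g n m := by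
  simpa using word_mem_wordSpan (K := K) (g := g) (l := [i]) hn hm

theorem mul_word_mem_wordSpan {g : κ → A} {n m : ℕ} {a : A} (ha : a ∈ wordSpan K g n m)
    (l : List κ) : a * word g l ∈ wordSpan K g n (m + l.length) := by
  suffices wordSpan K g n m ≤ (wordSpan K g n (m + l.length)).comap
      (LinearMap.mulRight K (word g l)) from this ha
  refine Submodule.span_le.2 ?_
  rintro _ ⟨w, ⟨hn, hm⟩, rfl⟩
  rw [SetLike.mem_coe, Submodule.mem_comap, LinearMap.mulRight_apply, ← word_append]
  exact word_mem_wordSpan (by grind) (by grind)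

theorem mul_mem_wordSpan_succ {g : κ → A} {n m : ℕ} {a : A} (ha : a ∈ wordSpan K g n m)
    (i : κ) : g i * a ∈ wordSpan K g n (m + 1) := by
  suffices wordSpan K g n m ≤ (wordSpan K g n (m + 1)).comap (LinearMap.mulLeft K (g i)) from
    this ha
  refine Submodule.span_le.2 ?_
  rintro _ ⟨w, ⟨hn, hm⟩, rfl⟩
  rw [SetLike.mem_coe, Submodule.mem_comap, LinearMap.mulLeft_apply, ← word_cons]
  exact word_mem_wordSpan (by grind) (by grind)

theorem word_sub_word_mem_of_perm {g : κ → A} {n : ℕ}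
    (hg : ∀ i j, g i * g j - g j * g i ∈ wordSpan K g n 2) {l l' : List κ} (h : l.Perm l') :
    word g l - word g l' ∈ wordSpan K g n l.length := by
  induction h with
  | nil => simp
  | cons i _ ih =>
    rw [word_cons, word_cons, ← mul_sub, List.length_cons]
    exact mul_mem_wordSpan_succ ih i
  | swap i j l =>
    have := mul_word_mem_wordSpan (hg j i) l
    simp only [word_cons, List.length_cons, ← mul_assoc, ← sub_mul]
    rwa [add_assoc, add_comm]
  | trans h₁ _ ih₁ ih₂ =>
    rw [← h₁.length_eq] at ih₂
    simpa using add_mem ih₁ ih₂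

theorem word_mem_span_of_surjective {ι : Type*} {g : κ → A} {n : ℕ}
    (hg : ∀ i j, g i * g j - g j * g i ∈ wordSpan K g n 2) {s : ι → List κ}
    (hs : Function.Surjective fun i => (s i : Multiset κ)) (l : List κ) (hl : n ≤ l.length) :
    word g l ∈ Submodule.span K ((word g ∘ s) '' {i | n ≤ (s i).length}) := by
  induction hk : l.length using Nat.strong_induction_on generalizing l with
  | _ k ih =>
    subst hk
    obtain ⟨i, hi⟩ := hs l
    have hperm : l.Perm (s i) := (Multiset.coe_eq_coe.1 hi).symm
    rw [← sub_add_cancel (word g l) (word g (s i))]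
    refine add_mem ?_ (Submodule.subset_span ⟨i, hl.trans hperm.length_eq.le, rfl⟩)
    refine Submodule.span_le.2 ?_ (word_sub_word_mem_of_perm hg hperm)
    rintro _ ⟨w, ⟨hn, hlt⟩, rfl⟩
    exact ih _ hlt w hn rfl

variable {α β : Type*}

/-- An ordering of the letters of a pair of multisets with the letters of the first kind in
front: the left factors and right factors of a standard monomial. -/
def splitList (p : Multiset α × Multiset β) : List (α ⊕ β) :=
  p.1.toList.map Sum.inl ++ p.2.toList.map Sum.inr

theorem coe_splitList (p : Multiset α × Multiset β) :
    (splitList p : Multiset (α ⊕ β)) = p.1.disjSum p.2 := by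
  simp [splitList, Multiset.disjSum, ← Multiset.coe_add, ← Multiset.map_coe]

theorem coe_splitList_bijective :
    Function.Bijective fun p : Multiset α × Multiset β => (splitList p : Multiset (α ⊕ β)) := by
  classical
  have count_inl (p : Multiset α × Multiset β) (a : α) :
      (p.1.disjSum p.2).count (.inl a) = p.1.count a := by
    simp [Multiset.disjSum, Multiset.count_map_eq_count' _ _ Sum.inl_injective]
  have count_inr (p : Multiset α × Multiset β) (b : β) :
      (p.1.disjSum p.2).count (.inr b) = p.2.count b := by
    simp [Multiset.disjSum, Multiset.count_map_eq_count' _ _ Sum.inr_injective]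
  simp only [coe_splitList]
  refine ⟨fun p q (h : p.1.disjSum p.2 = q.1.disjSum q.2) =>
    Prod.ext (Multiset.ext.2 fun a => ?_) (Multiset.ext.2 fun b => ?_),
    fun m => ?_⟩
  · rw [← count_inl, ← count_inl, h]
  · rw [← count_inr, ← count_inr, h]
  · induction m using Multiset.induction_on with
    | empty => exact ⟨0, rfl⟩
    | cons x m ih =>
      obtain ⟨p, rfl⟩ := ih
      rcases x with a | b
      · exact ⟨(a ::ₘ p.1, p.2), by simp [Multiset.disjSum]⟩
      · exact ⟨(p.1, b ::ₘ p.2), by simp [Multiset.disjSum]⟩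

theorem word_splitList (g : α ⊕ β → A) (p : Multiset α × Multiset β) :
    word g (splitList p)
      = word (g ∘ Sum.inl) p.1.toList * word (g ∘ Sum.inr) p.2.toList := by
  rw [splitList, word_append, word_map, word_map]

theorem word_splitList_mul_mem {g : α ⊕ β → A}
    (hg : ∀ k l : β, g (.inr k) * g (.inr l) - g (.inr l) * g (.inr k)
      ∈ wordSpan K (g ∘ Sum.inr) 1 2) (p : Multiset α × Multiset β) (k : β) :
    word g (splitList p) * g (.inr k)
      ∈ Submodule.span K ((word g ∘ splitList) '' {q | q.2 ≠ 0}) := by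
  let left := LinearMap.mulLeft K (word (g ∘ Sum.inl) p.1.toList)
  have hright : word g (splitList p) * g (.inr k)
      = left (word (g ∘ Sum.inr) (p.2.toList ++ [k])) := by
    simp [left, word_splitList, mul_assoc]
  have hspan := word_mem_span_of_surjective (n := 1) hg (s := Multiset.toList)
    (fun m => ⟨m, m.coe_toList⟩) (p.2.toList ++ [k]) (by simp)
  rw [hright]
  refine Submodule.mem_comap.1 (Submodule.span_le.2 ?_ hspan)
  rintro _ ⟨n, hn, rfl⟩
  refine Submodule.subset_span ⟨(p.1, n), ?_, word_splitList _ _⟩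
  rintro rfl
  simp at hn

end Words

/-! ### Linear independence of monomials in derivations -/

section Derivations

variable {K A κ : Type*} [Field K] [CommRing A] [Algebra K A]

theorem derivation_mem_pow (d : Derivation K A A) (I : Ideal A) (n : ℕ) {a : A}
    (ha : a ∈ I ^ (n + 1)) : d a ∈ I ^ n := by
  induction n generalizing a with
  | zero => simp
  | succ n ih =>
    rw [pow_succ'] at ha
    induction ha using Submodule.mul_induction_on' with
    | mem_mul_mem x hx y hy =>
      rw [d.leibniz, smul_eq_mul, smul_eq_mul]
      refine add_mem ?_ (Ideal.mul_mem_right _ _ hy)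
      rw [pow_succ']
      exact Ideal.mul_mem_mul hx (ih hy)
    | add x _ y _ hx hy => rw [map_add]; exact add_mem hx hy

/-- The operator `a ↦ d a - c a` on `A`. -/
def shiftedDerivation (d : κ → Derivation K A A) (c : κ → K) (j : κ) : Module.End K A :=
  (d j).toLinearMap - algebraMap K _ (c j)

theorem shiftedDerivation_apply (d : κ → Derivation K A A) (c : κ → K) (j : κ) (a : A) :
    shiftedDerivation d c j a = d j a - c j • a := rfl

theorem word_shiftedDerivation_mem_pow (d : κ → Derivation K A A) (c : κ → K) (I : Ideal A)
    (l : List κ) {n : ℕ} {a : A} (ha : a ∈ I ^ (n + l.length)) :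
    word (shiftedDerivation d c) l a ∈ I ^ n := by
  induction l generalizing n with
  | nil => simpa using ha
  | cons i l ih =>
    have h : word (shiftedDerivation d c) l a ∈ I ^ (n + 1) :=
      ih (by rwa [add_right_comm, add_assoc, ← List.length_cons])
    rw [word_cons, Module.End.mul_apply, shiftedDerivation_apply]
    exact sub_mem (derivation_mem_pow _ _ _ h)
      (Submodule.smul_of_tower_mem _ _ (Ideal.pow_le_pow_right n.le_succ h))

theorem eval_word_shiftedDerivation_eq_zero (ε : A →ₐ[K] K) (d : κ → Derivation K A A)
    (c : κ → K) (l : List κ) {n : ℕ} {a : A} (ha : a ∈ RingHom.ker ε ^ n) (hn : l.length < n) :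
    ε (word (shiftedDerivation d c) l a) = 0 := by
  have h : a ∈ RingHom.ker ε ^ (1 + l.length) := Ideal.pow_le_pow_right (by omega) ha
  simpa using word_shiftedDerivation_mem_pow d c _ l h

/-- A family of elements vanishing at the point `ε` such that the derivation `d j` acts on them to
leading order as the `j`-th partial derivative. -/
structure IsCoordinates [DecidableEq κ] (ε : A →ₐ[K] K) (d : κ → Derivation K A A)
    (t : κ → A) : Prop where
  map_eq_zero : ∀ i, ε (t i) = 0
  map_derivation : ∀ i j, ε (d j (t i)) = if i = j then 1 else 0

theorem pi_surjective_of_linearIndependent {V : Type*} [AddCommGroup V] [Module K V] [Finite κ]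
    {f : κ → Module.Dual K V} (hf : LinearIndependent K f) :
    Function.Surjective (LinearMap.pi f) := by
  have hfun : LinearIndependent K fun j v => f j v :=
    hf.map' (LinearMap.ltoFun K V K K) (LinearMap.ker_eq_bot.2 DFunLike.coe_injective)
  rw [← LinearMap.range_eq_top, ← top_le_iff, ← span_flip_eq_top_iff_linearIndependent.2 hfun,
    Submodule.span_le]
  rintro _ ⟨v, rfl⟩
  exact ⟨v, rfl⟩

theorem exists_isCoordinates [Finite κ] [DecidableEq κ] {ε : A →ₐ[K] K}
    {d : κ → Derivation K A A}
    (hd : LinearIndependent K fun j => ε.toLinearMap ∘ₗ (d j).toLinearMap) :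
    ∃ t : κ → A, IsCoordinates ε d t := by
  choose t ht using fun i => pi_surjective_of_linearIndependent hd (Pi.single i 1)
  refine ⟨fun i => t i - algebraMap K A (ε (t i)), fun i => by simp, fun i j => ?_⟩
  rw [map_sub, Derivation.map_algebraMap, sub_zero]
  exact (congrFun (ht i) j).trans (by simp [Pi.single_apply, eq_comm])

variable [DecidableEq κ] {ε : A →ₐ[K] K} {d : κ → Derivation K A A} {t : κ → A}

namespace IsCoordinates

theorem prod_mem_pow (ht : IsCoordinates ε d t) (m : Multiset κ) :
    (m.map t).prod ∈ RingHom.ker ε ^ m.card := by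
  induction m using Multiset.induction_on with
  | empty => simp
  | cons a m ih =>
    rw [Multiset.map_cons, Multiset.prod_cons, Multiset.card_cons, pow_succ']
    exact Ideal.mul_mem_mul (ht.map_eq_zero a) ih

theorem derivation_prod_sub_mem (ht : IsCoordinates ε d t) (j : κ) (m : Multiset κ) :
    d j (m.map t).prod - m.count j • ((m.erase j).map t).prod ∈ RingHom.ker ε ^ m.card := by
  induction m using Multiset.induction_on with
  | empty => simp
  | cons a m ih =>
    have hrec : t a * (d j (m.map t).prod - m.count j • ((m.erase j).map t).prod)
        ∈ RingHom.ker ε ^ (m.card + 1) :=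
      pow_succ' (RingHom.ker ε) _ ▸ Ideal.mul_mem_mul (ht.map_eq_zero a) ih
    have hnew : (d j (t a) - if a = j then 1 else 0) * (m.map t).prod
        ∈ RingHom.ker ε ^ (m.card + 1) := by
      refine pow_succ' (RingHom.ker ε) _ ▸ Ideal.mul_mem_mul ?_ (ht.prod_mem_pow m)
      rw [RingHom.mem_ker, map_sub, ht.map_derivation]
      split_ifs <;> simp
    rw [Multiset.card_cons]
    convert add_mem hrec hnew using 1
    rw [Multiset.map_cons, Multiset.prod_cons, Derivation.leibniz, smul_eq_mul, smul_eq_mul]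
    by_cases haj : a = j
    · subst haj
      have herase : m.count a • (m.map t).prod
          = t a * (m.count a • ((m.erase a).map t).prod) := by
        by_cases ham : a ∈ m
        · rw [mul_smul_comm, Multiset.prod_map_erase ham]
        · simp [Multiset.count_eq_zero_of_notMem ham]
      rw [Multiset.erase_cons_head, Multiset.count_cons_self, succ_nsmul, herase, if_pos rfl]
      ring
    · rw [Multiset.erase_cons_tail _ (by simpa using haj), Multiset.map_cons, Multiset.prod_cons,
        Multiset.count_cons_of_ne (Ne.symm haj), if_neg haj]
      simp only [nsmul_eq_mul]
      ring

variable (c : κ → K)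

theorem eval_word_concat (ht : IsCoordinates ε d t) (l : List κ) (j : κ) (m : Multiset κ)
    (hm : m.card = l.length + 1) :
    ε (word (shiftedDerivation d c) (l ++ [j]) (m.map t).prod)
      = m.count j * ε (word (shiftedDerivation d c) l ((m.erase j).map t).prod) := by
  have hd := eval_word_shiftedDerivation_eq_zero ε d c l (ht.derivation_prod_sub_mem j m) (by omega)
  have hc := eval_word_shiftedDerivation_eq_zero ε d c l (ht.prod_mem_pow m) (by omega)
  rw [map_sub, map_sub, sub_eq_zero] at hd
  rw [word_append, Module.End.mul_apply, word_cons, word_nil, mul_one, shiftedDerivation_apply,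
    map_sub, map_sub, map_smul, map_smul, hd, hc, smul_zero, sub_zero, map_nsmul, map_nsmul,
    nsmul_eq_mul]

theorem eval_word_prod_eq_zero_iff [CharZero K] (ht : IsCoordinates ε d t) (l : List κ)
    (m : Multiset κ) (hm : m.card = l.length) :
    ε (word (shiftedDerivation d c) l (m.map t).prod) = 0 ↔ (l : Multiset κ) ≠ m := by
  induction l using List.reverseRecOn generalizing m with
  | nil =>
    obtain rfl : m = 0 := by simpa using hm
    simp
  | append_singleton l j ih =>
    rw [List.length_append, List.length_singleton] at hm
    rw [ht.eval_word_concat c l j m hm]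
    by_cases hj : j ∈ m
    · obtain ⟨m, rfl⟩ := Multiset.exists_cons_of_mem hj
      have hcount : (((j ::ₘ m).count j : ℕ) : K) ≠ 0 := by
        simpa using Nat.cast_add_one_ne_zero (R := K) (m.count j)
      have hperm : ((l ++ [j] : List κ) : Multiset κ) = j ::ₘ (l : Multiset κ) :=
        Multiset.coe_eq_coe.2 (List.perm_append_singleton j l)
      rw [Multiset.card_cons, Nat.add_right_cancel_iff] at hm
      rw [Multiset.erase_cons_head, mul_eq_zero, ih m hm, or_iff_right hcount, hperm, Ne, Ne,
        Multiset.cons_inj_right]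
    · simp only [Multiset.count_eq_zero_of_notMem hj, Nat.cast_zero, zero_mul, true_iff]
      rintro rfl
      exact hj (by simp)

theorem linearIndependent_word [CharZero K] (ht : IsCoordinates ε d t) {ι : Type*}
    {s : ι → List κ} (hs : Function.Injective fun i => (s i : Multiset κ)) :
    LinearIndependent K (word (shiftedDerivation d c) ∘ s) := by
  rw [linearIndependent_iff]
  intro v hv
  by_contra hne
  obtain ⟨i, hi, hmax⟩ := v.support.exists_max_image (fun i => (s i).length)
    (Finsupp.support_nonempty_iff.2 hne)
  -- A word of maximal length is detected by the monomial in the coordinates with the same letters.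
  let a : A := ((s i : Multiset κ).map t).prod
  have heval : ∑ k ∈ v.support, v k * ε (word (shiftedDerivation d c) (s k) a) = 0 := by
    simpa [Finsupp.linearCombination_apply, Finsupp.sum] using congrArg (fun u => ε (u a)) hv
  rw [Finset.sum_eq_single i _ (absurd hi), mul_eq_zero] at heval
  · refine heval.elim (Finsupp.mem_support_iff.1 hi) fun h => ?_
    exact (ht.eval_word_prod_eq_zero_iff c (s i) (s i) rfl).1 h rfl
  · intro k hk hki
    rw [mul_eq_zero]
    right
    rcases (hmax k hk).lt_or_eq with hlt | heq
    · exact eval_word_shiftedDerivation_eq_zero ε d c (s k) (ht.prod_mem_pow _) hlt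
    · exact (ht.eval_word_prod_eq_zero_iff c (s k) (s i) heq.symm).2 fun h => hki (hs h)

end IsCoordinates

end Derivations

section EnvelopingAlgebra

open MvPolynomial in
/-- The action of matrices on polynomial functions of a matrix `X` by the derivations with
`D_M X = X M`. -/
def matrixDerivation (K n : Type*) [Field K] [Fintype n] [DecidableEq n] :
    Matrix n n K →ₗ⁅K⁆ Derivation K (MvPolynomial (n × n) K) (MvPolynomial (n × n) K) where
  toFun M := mkDerivation K fun p => ∑ k, M k p.2 • X (p.1, k)
  map_add' M N := derivation_ext fun p => by
    simp [mkDerivation_X, add_smul, Finset.sum_add_distrib]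
  map_smul' c M := derivation_ext fun p => by
    simp [mkDerivation_X, mul_smul, Finset.smul_sum]
  map_lie' := fun {M N} => derivation_ext fun p => by
    have key (M N : Matrix n n K) : ∑ k, N k p.2 • ∑ i, M i k • (X (p.1, i) : MvPolynomial _ K)
        = ∑ i, (M * N) i p.2 • X (p.1, i) := by
      simp only [Finset.smul_sum, smul_smul, Matrix.mul_apply, Finset.sum_smul]
      rw [Finset.sum_comm]
      exact Finset.sum_congr rfl fun i _ => Finset.sum_congr rfl fun k _ => by rw [mul_comm]
    simp [Derivation.commutator_apply, mkDerivation_X, key, LieRing.of_associative_ring_bracket,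
      sub_smul, Finset.sum_sub_distrib]

/-- Evaluation of polynomial functions of a matrix at the identity matrix. -/
def evalOne (K n : Type*) [Field K] [DecidableEq n] : MvPolynomial (n × n) K →ₐ[K] K :=
  MvPolynomial.aeval fun p => (1 : Matrix n n K) p.1 p.2

theorem evalOne_matrixDerivation_X {K n : Type*} [Field K] [Fintype n] [DecidableEq n]
    (M : Matrix n n K) (i j : n) :
    evalOne K n (matrixDerivation K n M (MvPolynomial.X (i, j))) = M i j := by
  simp [matrixDerivation, evalOne, MvPolynomial.mkDerivation_X, Matrix.one_apply]

open UniversalEnvelopingAlgebra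

variable {K 𝔤 : Type*} [Field K] [LieRing 𝔤] [LieAlgebra K 𝔤]

theorem adjoin_range_ι :
    Algebra.adjoin K (Set.range (ι K : 𝔤 → UniversalEnvelopingAlgebra K 𝔤)) = ⊤ := by
  let S := Algebra.adjoin K (Set.range (ι K : 𝔤 → UniversalEnvelopingAlgebra K 𝔤))
  let f : 𝔤 →ₗ⁅K⁆ S :=
    { toFun := fun x => ⟨ι K x, Algebra.subset_adjoin ⟨x, rfl⟩⟩
      map_add' := fun x y => Subtype.ext (map_add (ι K) x y)
      map_smul' := fun c x => Subtype.ext (map_smul (ι K) c x)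
      map_lie' := fun {x y} => Subtype.ext (LieHom.map_lie (ι K) x y) }
  have hid : S.val.comp (lift K f) = AlgHom.id K _ :=
    hom_ext K (LieHom.ext fun x => congrArg S.val (lift_ι_apply K f x))
  refine eq_top_iff.2 fun u _ => ?_
  rw [← AlgHom.id_apply (R := K) u, ← hid]
  exact (lift K f u).2

theorem eq_zero_of_ι_eq_algebraMap (V : Type*) [AddCommGroup V] [Module K V] [LieRingModule 𝔤 V]
    [LieModule K 𝔤 V] [LieModule.IsFaithful K 𝔤 V] {x : 𝔤} {c : K}
    (h : ι K x = algebraMap K (UniversalEnvelopingAlgebra K 𝔤) c) : x = 0 := by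
  have hc : 0 = c := by simpa using congrArg (lift K (0 : 𝔤 →ₗ⁅K⁆ K)) h
  subst hc
  refine LieModule.IsFaithful.injective_toEnd (R := K) (M := V) ?_
  simpa using congrArg (lift K (LieModule.toEnd K 𝔤 V)) h

variable {κ : Type*}

/-- The elements `e j - c j` of the enveloping algebra. -/
def shiftedι (e : κ → 𝔤) (c : κ → K) (j : κ) : UniversalEnvelopingAlgebra K 𝔤 :=
  ι K (e j) - algebraMap K _ (c j)

theorem shiftedι_commutator (e : κ → 𝔤) (c : κ → K) (i j : κ) :
    shiftedι e c i * shiftedι e c j - shiftedι e c j * shiftedι e c i = ι K ⁅e i, e j⁆ := by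
  rw [LieHom.map_lie, LieRing.of_associative_ring_bracket, shiftedι, shiftedι]
  simp only [sub_mul, mul_sub, Algebra.commutes (c i), Algebra.commutes (c j) (ι K (e i))]
  abel

theorem adjoin_range_shiftedι {e : κ → 𝔤} (he : Submodule.span K (Set.range e) = ⊤)
    (c : κ → K) : Algebra.adjoin K (Set.range (shiftedι e c)) = ⊤ := by
  set S := Algebra.adjoin K (Set.range (shiftedι e c))
  suffices Submodule.span K (Set.range e) ≤ S.toSubmodule.comap (ι K).toLinearMap by
    rw [← top_le_iff, ← adjoin_range_ι, Algebra.adjoin_le_iff]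
    rintro _ ⟨x, rfl⟩
    exact this (he ▸ Submodule.mem_top)
  refine Submodule.span_le.2 ?_
  rintro _ ⟨j, rfl⟩
  have h : shiftedι e c j + algebraMap K _ (c j) ∈ S :=
    add_mem (Algebra.subset_adjoin ⟨j, rfl⟩) (S.algebraMap_mem _)
  simpa [shiftedι] using h

theorem ι_mem_wordSpan_shiftedι {e : κ → 𝔤} (he : Submodule.span K (Set.range e) = ⊤)
    (c : κ → K) (x : 𝔤) : ι K x ∈ wordSpan K (shiftedι e c) 0 2 := by
  suffices Submodule.span K (Set.range e) ≤
      (wordSpan K (shiftedι e c) 0 2).comap (ι K).toLinearMap from this (he ▸ Submodule.mem_top)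
  refine Submodule.span_le.2 ?_
  rintro _ ⟨j, rfl⟩
  have h : shiftedι e c j + c j • word (shiftedι e c) [] ∈ wordSpan K (shiftedι e c) 0 2 :=
    add_mem (self_mem_wordSpan _ zero_le_one one_lt_two j)
      (Submodule.smul_mem _ _ (word_mem_wordSpan (by simp) (by simp)))
  simpa [shiftedι, Algebra.algebraMap_eq_smul_one] using h

theorem span_word_shiftedι {ι' : Type*} {e : κ → 𝔤} (he : Submodule.span K (Set.range e) = ⊤)
    (c : κ → K) {s : ι' → List κ} (hs : Function.Surjective fun i => (s i : Multiset κ)) :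
    Submodule.span K (Set.range (word (shiftedι e c) ∘ s)) = ⊤ := by
  rw [← top_le_iff, ← span_range_word_eq_top (adjoin_range_shiftedι he c), Submodule.span_le]
  rintro _ ⟨l, rfl⟩
  have hcomm (i j : κ) : shiftedι e c i * shiftedι e c j - shiftedι e c j * shiftedι e c i
      ∈ wordSpan K (shiftedι e c) 0 2 :=
    shiftedι_commutator e c i j ▸ ι_mem_wordSpan_shiftedι he c _
  exact Submodule.span_mono (Set.image_subset_range _ _)
    (word_mem_span_of_surjective hcomm hs l (Nat.zero_le _))

variable [CharZero K] [Finite κ]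

theorem linearIndependent_word_shiftedι_of_derivation {A ι' : Type*} [CommRing A] [Algebra K A]
    (D : 𝔤 →ₗ⁅K⁆ Derivation K A A) (ε : A →ₐ[K] K) (hD : ∀ x, (∀ a, ε (D x a) = 0) → x = 0)
    {e : κ → 𝔤} (he : LinearIndependent K e) (c : κ → K) {s : ι' → List κ}
    (hs : Function.Injective fun i => (s i : Multiset κ)) :
    LinearIndependent K (word (shiftedι e c) ∘ s) := by
  classical
  let δ : 𝔤 →ₗ[K] Module.Dual K A :=
    { toFun := fun x => ε.toLinearMap ∘ₗ (D x).toLinearMap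
      map_add' := fun x y => by ext; simp
      map_smul' := fun r x => by ext; simp }
  have hδ : LinearMap.ker δ = ⊥ :=
    (Submodule.eq_bot_iff _).2 fun x hx => hD x fun a => LinearMap.congr_fun hx a
  obtain ⟨t, ht⟩ := exists_isCoordinates (he.map' δ hδ)
  let act : UniversalEnvelopingAlgebra K 𝔤 →ₐ[K] Module.End K A :=
    lift K ((LieModule.toEnd K (Derivation K A A) A).comp D)
  have hact : act ∘ shiftedι e c = shiftedDerivation (fun j => D (e j)) c := by
    ext j a
    simp [act, shiftedι, shiftedDerivation]
  have hword : act.toLinearMap ∘ word (shiftedι e c) ∘ s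
      = word (shiftedDerivation (fun j => D (e j)) c) ∘ s := by
    ext i : 1
    simp [map_word, hact]
  exact LinearIndependent.of_comp act.toLinearMap (hword ▸ ht.linearIndependent_word c hs)

theorem linearIndependent_word_shiftedι {ι' : Type*} (V : Type*) [AddCommGroup V] [Module K V]
    [FiniteDimensional K V] [LieRingModule 𝔤 V] [LieModule K 𝔤 V] [LieModule.IsFaithful K 𝔤 V]
    {e : κ → 𝔤} (he : LinearIndependent K e) (c : κ → K) {s : ι' → List κ}
    (hs : Function.Injective fun i => (s i : Multiset κ)) :
    LinearIndependent K (word (shiftedι e c) ∘ s) := by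
  classical
  let b := Module.finBasis K V
  let toMatrix := (LinearMap.toMatrixAlgEquiv b).toAlgHom.toLieHom.comp (LieModule.toEnd K 𝔤 V)
  refine linearIndependent_word_shiftedι_of_derivation ((matrixDerivation K _).comp toMatrix)
    (evalOne K (Fin (Module.finrank K V))) (fun x hx => ?_) he c hs
  have hmat : toMatrix x = 0 := by
    ext i j
    exact (evalOne_matrixDerivation_X _ i j).symm.trans (hx _)
  refine LieModule.IsFaithful.injective_toEnd (R := K) (M := V) ?_
  rw [map_zero]
  exact (LinearMap.toMatrixAlgEquiv b).injective (hmat.trans (map_zero _).symm)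

end EnvelopingAlgebra

section CharacterIdeal

open UniversalEnvelopingAlgebra

variable {K 𝔤 : Type*} [Field K] [LieRing 𝔤] [LieAlgebra K 𝔤] {α β : Type*}

theorem mem_span_word_of_mem_ideal_span {e : α ⊕ β → 𝔤} {c : α ⊕ β → K}
    (he : Submodule.span K (Set.range e) = ⊤)
    (hc : ∀ k l : β, ι K ⁅e (.inr k), e (.inr l)⁆ ∈ wordSpan K (shiftedι e c ∘ Sum.inr) 1 2)
    {u : UniversalEnvelopingAlgebra K 𝔤}
    (hu : u ∈ Ideal.span (Set.range (shiftedι e c ∘ Sum.inr))) :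
    u ∈ Submodule.span K ((word (shiftedι e c) ∘ splitList) '' {p | p.2 ≠ 0}) := by
  set W := Submodule.span K ((word (shiftedι e c) ∘ splitList) '' {p | p.2 ≠ 0})
  induction hu using Submodule.closure_induction with
  | zero => exact zero_mem W
  | add u v _ _ hu hv => exact add_mem hu hv
  | smul_mem u v hv =>
    obtain ⟨k, rfl⟩ := hv
    suffices Submodule.span K (Set.range (word (shiftedι e c) ∘ splitList)) ≤
        W.comap (LinearMap.mulRight K (shiftedι e c (.inr k))) from
      this (span_word_shiftedι he c coe_splitList_bijective.surjective ▸ Submodule.mem_top)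
    refine Submodule.span_le.2 ?_
    rintro _ ⟨p, rfl⟩
    exact word_splitList_mul_mem
      (fun k l => shiftedι_commutator e c (.inr k) (.inr l) ▸ hc k l) p k

theorem ι_add_algebraMap_mem_span_word (e : α ⊕ β → 𝔤) (c : α ⊕ β → K) {x : 𝔤}
    (hx : x ∈ Submodule.span K (Set.range (e ∘ Sum.inl))) (r : K) :
    ι K x + algebraMap K _ r
      ∈ Submodule.span K ((word (shiftedι e c) ∘ splitList) '' {p | p.2 = 0}) := by
  set W := Submodule.span K ((word (shiftedι e c) ∘ splitList) '' {p | p.2 = 0})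
  have hscalar (r : K) : algebraMap K _ r ∈ W := by
    rw [Algebra.algebraMap_eq_smul_one]
    exact Submodule.smul_mem _ _ (Submodule.subset_span ⟨(0, 0), rfl, by simp [splitList]⟩)
  suffices Submodule.span K (Set.range (e ∘ Sum.inl)) ≤ W.comap (ι K).toLinearMap from
    add_mem (this hx) (hscalar r)
  refine Submodule.span_le.2 ?_
  rintro _ ⟨i, rfl⟩
  have hletter : shiftedι e c (.inl i) ∈ W :=
    Submodule.subset_span ⟨({i}, 0), rfl, by simp [splitList]⟩
  simpa [shiftedι] using add_mem hletter (hscalar (c (.inl i)))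

theorem span_range_coe_basis {W : Submodule K 𝔤} (b : Module.Basis α K W) :
    Submodule.span K (Set.range fun i => (b i : 𝔤)) = W := by
  rw [show (fun i => (b i : 𝔤)) = W.subtype ∘ b from rfl, Set.range_comp, Submodule.span_image,
    b.span_eq, Submodule.map_top, Submodule.range_subtype]

variable (𝔪 : LieSubalgebra K 𝔤) (χ : 𝔪 →ₗ[K] K)

theorem ι_sub_algebraMap_mem_span (b : Module.Basis β K 𝔪) (z : 𝔪) :
    ι K (z : 𝔤) - algebraMap K _ (χ z)
      ∈ Submodule.span K (Set.range (shiftedι (fun k => (b k : 𝔤)) fun k => χ (b k))) := by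
  let shift : 𝔪 →ₗ[K] UniversalEnvelopingAlgebra K 𝔤 :=
    (ι K).toLinearMap ∘ₗ 𝔪.toSubmodule.subtype - Algebra.linearMap K _ ∘ₗ χ
  suffices Submodule.span K (Set.range b) ≤ (Submodule.span K (Set.range
      (shiftedι (fun k => (b k : 𝔤)) fun k => χ (b k)))).comap shift from
    this (b.span_eq ▸ Submodule.mem_top)
  refine Submodule.span_le.2 ?_
  rintro _ ⟨k, rfl⟩
  exact Submodule.subset_span ⟨k, rfl⟩

theorem eq_zero_of_ι_add_algebraMap_mem_ideal_span [CharZero K] (V : Type*) [AddCommGroup V]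
    [Module K V] [FiniteDimensional K V] [LieRingModule 𝔤 V] [LieModule K 𝔤 V]
    [LieModule.IsFaithful K 𝔤 V] [Finite α] [Finite β] {e : α ⊕ β → 𝔤} {c : α ⊕ β → K}
    (hli : LinearIndependent K e) (hspan : Submodule.span K (Set.range e) = ⊤)
    (hc : ∀ k l : β, ι K ⁅e (.inr k), e (.inr l)⁆ ∈ wordSpan K (shiftedι e c ∘ Sum.inr) 1 2)
    {x : 𝔤} (hx : x ∈ Submodule.span K (Set.range (e ∘ Sum.inl))) {r : K}
    (h : ι K x + algebraMap K _ r ∈ Ideal.span (Set.range (shiftedι e c ∘ Sum.inr))) : x = 0 := by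
  have hindep : LinearIndependent K (word (shiftedι e c) ∘ splitList) :=
    linearIndependent_word_shiftedι V hli c coe_splitList_bijective.injective
  have hdisj : Disjoint {p : Multiset α × Multiset β | p.2 = 0} {p | p.2 ≠ 0} :=
    Set.disjoint_left.2 fun p hp hp' => hp' hp
  have hzero : ι K x + algebraMap K _ r = 0 := Submodule.disjoint_def.1
    (hindep.disjoint_span_image hdisj) _ (ι_add_algebraMap_mem_span_word e c hx r)
    (mem_span_word_of_mem_ideal_span hspan hc h)
  exact eq_zero_of_ι_eq_algebraMap V
    ((eq_neg_of_add_eq_zero_left hzero).trans (map_neg _ r).symm)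

theorem mem_of_ι_mem_ideal_span [CharZero K] [FiniteDimensional K 𝔤] (V : Type*)
    [AddCommGroup V] [Module K V] [FiniteDimensional K V] [LieRingModule 𝔤 V] [LieModule K 𝔤 V]
    [LieModule.IsFaithful K 𝔤 V] (hχ : ∀ x y : 𝔪, χ ⁅x, y⁆ = 0) {y : 𝔤}
    (hy : ι K y ∈ Ideal.span (Set.range fun z : 𝔪 =>
      ι K (z : 𝔤) - algebraMap K (UniversalEnvelopingAlgebra K 𝔤) (χ z))) : y ∈ 𝔪 := by
  obtain ⟨C, hC⟩ := 𝔪.toSubmodule.exists_isCompl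
  let b₁ := Module.finBasis K C
  let b₂ : Module.Basis _ K 𝔪 := Module.finBasis K 𝔪
  let e := (b₁.prod b₂).map (Submodule.prodEquivOfIsCompl C 𝔪.toSubmodule hC.symm)
  let c := Sum.elim (0 : Fin (Module.finrank K C) → K) fun k => χ (b₂ k)
  have he (j) : e j = (b₁.prod b₂ j).1 + (b₁.prod b₂ j).2 := rfl
  have he_inl : e ∘ Sum.inl = fun i => (b₁ i : 𝔤) := by ext i; simp [he]
  have he_inr : e ∘ Sum.inr = fun k => (b₂ k : 𝔤) := by ext k; simp [he]
  have hshift : shiftedι e c ∘ Sum.inr = shiftedι (fun k => (b₂ k : 𝔤)) fun k => χ (b₂ k) :=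
    he_inr ▸ rfl
  have hgen (z : 𝔪) := hshift ▸ ι_sub_algebraMap_mem_span 𝔪 χ b₂ z
  have hcomm (k l) : ι K ⁅e (.inr k), e (.inr l)⁆ ∈ wordSpan K (shiftedι e c ∘ Sum.inr) 1 2 := by
    have h := hgen ⁅b₂ k, b₂ l⁆
    rw [hχ, map_zero, sub_zero, LieSubalgebra.coe_bracket, ← congrFun he_inr k,
      ← congrFun he_inr l] at h
    refine Submodule.span_le.2 ?_ h
    rintro _ ⟨r, rfl⟩
    exact self_mem_wordSpan _ le_rfl one_lt_two r
  have hideal (z : 𝔪) : ι K (z : 𝔤) - algebraMap K _ (χ z)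
      ∈ Ideal.span (Set.range (shiftedι e c ∘ Sum.inr)) :=
    Submodule.span_le_restrictScalars K _ _ (hgen z)
  obtain ⟨z, hz, x, hx, rfl⟩ := Submodule.mem_sup.1 (hC.sup_eq_top ▸ Submodule.mem_top (x := y))
  have hx_mem : ι K x + algebraMap K _ (χ ⟨z, hz⟩)
      ∈ Ideal.span (Set.range (shiftedι e c ∘ Sum.inr)) := by
    have h := sub_mem (Submodule.span_le.2 (Set.range_subset_iff.2 hideal) hy) (hideal ⟨z, hz⟩)
    convert h using 1
    rw [map_add]
    abel
  have hx₀ : x = 0 := eq_zero_of_ι_add_algebraMap_mem_ideal_span V e.linearIndependent e.span_eq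
    hcomm (he_inl ▸ (span_range_coe_basis b₁).symm ▸ hx) hx_mem
  rwa [hx₀, add_zero]

end CharacterIdeal

/-! ### The Euler operator and Whittaker vectors -/

section Whittaker

open UniversalEnvelopingAlgebra

/-- The input of the Euler operator: a graded Lie algebra with a linear form `χ` of degree `-2`
which is a character of a graded subalgebra `𝔪` containing all components of degree at least `2`,
and homogeneous families `z` in `𝔪` and `x` in `𝔤`. These are dual for the pairing `χ ⁅·, ·⁆`,
in the sense that `z` spans `𝔪` with coefficients given by pairing with `x`. -/
structure WhittakerGrading (K 𝔤 κ : Type*) [Field K] [LieRing 𝔤] [LieAlgebra K 𝔤] [Fintype κ] where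
  Γ : ℤ → Submodule K 𝔤
  χ : 𝔤 →ₗ[K] K
  𝔪 : LieSubalgebra K 𝔤
  deg : κ → ℤ
  z : κ → 𝔤
  x : κ → 𝔤
  iSup_eq_top : ⨆ i, Γ i = ⊤
  lie_mem : ∀ {i j : ℤ} {a b : 𝔤}, a ∈ Γ i → b ∈ Γ j → ⁅a, b⁆ ∈ Γ (i + j)
  χ_eq_zero : ∀ {i : ℤ} {a : 𝔤}, a ∈ Γ i → i ≠ 2 → χ a = 0
  χ_lie : ∀ {a b : 𝔤}, a ∈ 𝔪 → b ∈ 𝔪 → χ ⁅a, b⁆ = 0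
  mem_𝔪 : ∀ {i : ℤ} {a : 𝔤}, 2 ≤ i → a ∈ Γ i → a ∈ 𝔪
  𝔪_le : 𝔪.toSubmodule ≤ ⨆ (i : ℤ) (_ : 1 ≤ i), 𝔪.toSubmodule ⊓ Γ i
  one_le_deg : ∀ k, 1 ≤ deg k
  z_mem_𝔪 : ∀ k, z k ∈ 𝔪
  z_mem_Γ : ∀ k, z k ∈ Γ (deg k)
  x_mem_Γ : ∀ k, x k ∈ Γ (2 - deg k)
  sum_χ_lie_x_smul_z : ∀ {i : ℤ} {a : 𝔤}, 1 ≤ i → a ∈ 𝔪 → a ∈ Γ i → ∑ k, χ ⁅a, x k⁆ • z k = a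

namespace WhittakerGrading

variable {K 𝔤 κ : Type*} [Field K] [LieRing 𝔤] [LieAlgebra K 𝔤] [Fintype κ]
  (W : WhittakerGrading K 𝔤 κ)

/-- The shifted inclusion `a ↦ a - χ a` of `𝔤` into its enveloping algebra. A Whittaker vector is
a vector annihilated by the image of `𝔪`. -/
def shift : 𝔤 →ₗ[K] UniversalEnvelopingAlgebra K 𝔤 :=
  (ι K).toLinearMap - Algebra.linearMap K _ ∘ₗ W.χ

theorem shift_apply (a : 𝔤) : W.shift a = ι K a - algebraMap K _ (W.χ a) := rfl

theorem ι_eq_shift_add (a : 𝔤) : ι K a = W.shift a + algebraMap K _ (W.χ a) := by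
  simp [shift_apply]

theorem shift_mul_shift (a b : 𝔤) :
    W.shift a * W.shift b
      = W.shift b * W.shift a + (W.shift ⁅a, b⁆ + algebraMap K _ (W.χ ⁅a, b⁆)) := by
  have h := shiftedι_commutator id W.χ a b
  rw [← ι_eq_shift_add]
  exact sub_eq_iff_eq_add'.1 h

/-- The elements of `𝔪` that are homogeneous of degree `i ≥ 1`. -/
def IsHomogeneous (i : ℤ) (a : 𝔤) : Prop := 1 ≤ i ∧ a ∈ W.𝔪 ∧ a ∈ W.Γ i

/-- The Euler operator `∑ x k * z k`, a deformation of the degree in the polynomial functions on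
`𝔪`. -/
def euler : UniversalEnvelopingAlgebra K 𝔤 := ∑ k, W.shift (W.x k) * W.shift (W.z k)

variable {M : Type*} [AddCommGroup M] [Module (UniversalEnvelopingAlgebra K 𝔤) M]

variable (M) in
/-- The filtration of a module by the vectors that are annihilated by all products of shifted
homogeneous elements of `𝔪` of total degree greater than `p`, and by those of total degree `p` with
less than `l` factors. -/
def fil (p : ℤ) (l : ℕ) : AddSubgroup M where
  carrier := {v | ∀ w : List (ℤ × 𝔤), (∀ a ∈ w, W.IsHomogeneous a.1 a.2) →
    (p < (w.map Prod.fst).sum ∨ p = (w.map Prod.fst).sum ∧ w.length < l) →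
    word (fun a => W.shift a.2) w • v = 0}
  zero_mem' := fun _ _ _ => smul_zero _
  add_mem' := fun ha hb w hw h => by rw [smul_add, ha w hw h, hb w hw h, add_zero]
  neg_mem' := fun ha w hw h => by rw [smul_neg, ha w hw h, neg_zero]

variable {W} {p p' i : ℤ} {l l' : ℕ} {v : M} {a : 𝔤}

theorem algebraMap_smul_mem_fil (c : K) (hv : v ∈ W.fil M p l) :
    algebraMap K (UniversalEnvelopingAlgebra K 𝔤) c • v ∈ W.fil M p l := by
  intro w hw h
  rw [smul_smul, ← Algebra.commutes, mul_smul, hv w hw h, smul_zero]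

theorem fil_mono (h : p < p' ∨ p = p' ∧ l' ≤ l) (hv : v ∈ W.fil M p l) : v ∈ W.fil M p' l' :=
  fun w hw h' => hv w hw (by omega)

theorem eq_zero_of_mem_fil (h : p < 0 ∨ p = 0 ∧ 0 < l) (hv : v ∈ W.fil M p l) : v = 0 := by
  simpa using hv [] (by simp) (by simpa using h)

theorem shift_smul_mem_fil_sub (ha : W.IsHomogeneous i a) (hv : v ∈ W.fil M p l) :
    W.shift a • v ∈ W.fil M (p - i) (l - 1) := by
  intro w hw h
  have hw' : ∀ b ∈ w ++ [(i, a)], W.IsHomogeneous b.1 b.2 :=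
    List.forall_mem_append.2 ⟨hw, List.forall_mem_singleton.2 ha⟩
  have := hv (w ++ [(i, a)]) hw' (by
    simp only [List.map_append, List.sum_append, List.map_cons, List.map_nil, List.sum_cons,
      List.sum_nil, List.length_append, List.length_cons, List.length_nil]
    omega)
  simpa [mul_smul] using this

theorem mem_fil_of_shift_smul_mem (hp : 0 < p)
    (h : ∀ i a, W.IsHomogeneous i a → W.shift a • v ∈ W.fil M (p - i) (l - 1)) :
    v ∈ W.fil M p l := by
  intro w hw hw'
  induction w using List.reverseRecOn with
  | nil => simp at hw'; omega
  | append_singleton w b _ =>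
    simp only [List.map_append, List.sum_append, List.map_cons, List.map_nil, List.sum_cons,
      List.sum_nil, List.length_append, List.length_cons, List.length_nil] at hw'
    have := h b.1 b.2 (hw b (by simp)) w (fun a ha => hw a (by simp [ha])) (by omega)
    simpa [mul_smul] using this

theorem shift_smul_mem_fil_add {d : ℤ} (ha : a ∈ W.Γ (2 - d)) (hv : v ∈ W.fil M p l) :
    W.shift a • v ∈ W.fil M (p + d) (l + 1) := by
  obtain ⟨n, hn⟩ : ∃ n : ℕ, p + d < n := ⟨(p + d).toNat + 1, by push_cast; omega⟩
  induction n generalizing p d l v a with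
  | zero =>
    rcases le_or_gt d 0 with hd | hd
    · exact fil_mono (by omega)
        (shift_smul_mem_fil_sub ⟨by omega, W.mem_𝔪 (by omega) ha, ha⟩ hv)
    · rw [eq_zero_of_mem_fil (by omega) hv, smul_zero]
      exact zero_mem _
  | succ n ih =>
    rcases le_or_gt d 0 with hd | hd
    · exact fil_mono (by omega)
        (shift_smul_mem_fil_sub ⟨by omega, W.mem_𝔪 (by omega) ha, ha⟩ hv)
    rcases lt_or_ge p 0 with hp | hp
    · rw [eq_zero_of_mem_fil (by omega) hv, smul_zero]
      exact zero_mem _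
    refine mem_fil_of_shift_smul_mem (by omega) fun i b hb => ?_
    have hi := hb.1
    have hba : ⁅b, a⁆ ∈ W.Γ (2 - (d - i)) := by
      convert W.lie_mem hb.2.2 ha using 2
      ring
    rw [← mul_smul, shift_mul_shift, add_smul, add_smul, mul_smul]
    refine add_mem ?_ (add_mem ?_ ?_)
    · exact fil_mono (by omega) (ih ha (shift_smul_mem_fil_sub hb hv) (by omega))
    · exact fil_mono (by omega) (ih hba hv (by omega))
    · by_cases hdi : d = i
      · exact fil_mono (by omega) (algebraMap_smul_mem_fil _ hv)
      · rw [W.χ_eq_zero hba (by omega), map_zero, zero_smul]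
        exact zero_mem _

theorem isHomogeneous_z (k : κ) : W.IsHomogeneous (W.deg k) (W.z k) :=
  ⟨W.one_le_deg k, W.z_mem_𝔪 k, W.z_mem_Γ k⟩

theorem euler_smul_mem_fil (hv : v ∈ W.fil M p l) : W.euler • v ∈ W.fil M p l := by
  rw [euler, Finset.sum_smul]
  refine sum_mem fun k _ => ?_
  rw [mul_smul]
  exact fil_mono (by omega)
    (shift_smul_mem_fil_add (W.x_mem_Γ k) (shift_smul_mem_fil_sub (isHomogeneous_z k) hv))

theorem euler_smul_eq_zero (hp : p ≤ 0) (hv : v ∈ W.fil M p l) : W.euler • v = 0 := by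
  rw [euler, Finset.sum_smul]
  refine Finset.sum_eq_zero fun k _ => ?_
  have hk := W.one_le_deg k
  rw [mul_smul, eq_zero_of_mem_fil (by omega) (shift_smul_mem_fil_sub (isHomogeneous_z k) hv),
    smul_zero]

variable (W) in
theorem shift_mul_euler (ha : W.IsHomogeneous i a) :
    W.shift a * W.euler = W.euler * W.shift a + W.shift a
      + ∑ k, (W.shift ⁅a, W.x k⁆ * W.shift (W.z k) + W.shift (W.x k) * W.shift ⁅a, W.z k⁆) := by
  have hdual : W.shift a = ∑ k, algebraMap K _ (W.χ ⁅a, W.x k⁆) * W.shift (W.z k) := by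
    conv_lhs => rw [← W.sum_χ_lie_x_smul_z ha.1 ha.2.1 ha.2.2]
    simp [Algebra.smul_def]
  have hsum : W.euler * W.shift a + W.shift a
      = ∑ k, (W.shift (W.x k) * W.shift (W.z k) * W.shift a
        + algebraMap K _ (W.χ ⁅a, W.x k⁆) * W.shift (W.z k)) := by
    rw [Finset.sum_add_distrib, ← hdual, euler, Finset.sum_mul]
  rw [hsum, euler, Finset.mul_sum, ← Finset.sum_add_distrib]
  refine Finset.sum_congr rfl fun k _ => ?_
  have hz : W.shift a * W.shift (W.z k) = W.shift (W.z k) * W.shift a + W.shift ⁅a, W.z k⁆ := by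
    rw [shift_mul_shift, W.χ_lie ha.2.1 (W.z_mem_𝔪 k), map_zero, add_zero]
  rw [← mul_assoc, shift_mul_shift, add_mul, mul_assoc, hz]
  noncomm_ring

theorem lie_euler_term_smul_mem_fil (ha : W.IsHomogeneous i a) (hv : v ∈ W.fil M p l) (k : κ) :
    (W.shift ⁅a, W.x k⁆ * W.shift (W.z k) + W.shift (W.x k) * W.shift ⁅a, W.z k⁆) • v
      ∈ W.fil M (p - i) l := by
  have hi := ha.1
  have hk := W.one_le_deg k
  have hx : ⁅a, W.x k⁆ ∈ W.Γ (2 - (W.deg k - i)) := by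
    convert W.lie_mem ha.2.2 (W.x_mem_Γ k) using 2
    ring
  have hz : W.IsHomogeneous (i + W.deg k) ⁅a, W.z k⁆ :=
    ⟨by omega, W.𝔪.lie_mem ha.2.1 (W.z_mem_𝔪 k), W.lie_mem ha.2.2 (W.z_mem_Γ k)⟩
  rw [add_smul, mul_smul, mul_smul]
  refine add_mem (fil_mono (by omega)
    (shift_smul_mem_fil_add hx (shift_smul_mem_fil_sub (isHomogeneous_z k) hv))) ?_
  exact fil_mono (by omega)
    (shift_smul_mem_fil_add (W.x_mem_Γ k) (shift_smul_mem_fil_sub hz hv))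

theorem euler_sub_smul_mem_fil (hv : v ∈ W.fil M p l) :
    (W.euler - (l : UniversalEnvelopingAlgebra K 𝔤)) • v ∈ W.fil M p (l + 1) := by
  obtain ⟨n, hn⟩ : ∃ n : ℕ, p ≤ n := ⟨p.toNat, Int.self_le_toNat _⟩
  induction n generalizing p l v with
  | zero =>
    by_cases h0 : p < 0 ∨ p = 0 ∧ 0 < l
    · rw [eq_zero_of_mem_fil h0 hv, smul_zero]
      exact zero_mem _
    obtain rfl : l = 0 := by omega
    rw [Nat.cast_zero, sub_zero, euler_smul_eq_zero (by omega) hv]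
    exact zero_mem _
  | succ n ih =>
    rcases le_or_gt p 0 with hp | hp
    · exact ih hv (by omega)
    refine mem_fil_of_shift_smul_mem hp fun i a ha => ?_
    rcases l with _ | l
    · rw [Nat.cast_zero, sub_zero]
      exact shift_smul_mem_fil_sub (l := 0) ha (euler_smul_mem_fil hv)
    have hi := ha.1
    have hmain := ih (shift_smul_mem_fil_sub ha hv) (by omega)
    have hcomm : W.shift a * (W.euler - ((l + 1 : ℕ) : UniversalEnvelopingAlgebra K 𝔤))
        = (W.euler - ((l + 1 - 1 : ℕ) : UniversalEnvelopingAlgebra K 𝔤)) * W.shift a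
          + ∑ k, (W.shift ⁅a, W.x k⁆ * W.shift (W.z k)
            + W.shift (W.x k) * W.shift ⁅a, W.z k⁆) := by
      rw [mul_sub, W.shift_mul_euler ha, Nat.add_sub_cancel, Nat.cast_add, Nat.cast_one, mul_add,
        ← Nat.cast_comm]
      noncomm_ring
    rw [← mul_smul, hcomm, add_smul, mul_smul, Finset.sum_smul]
    exact add_mem hmain (sum_mem fun k _ => lie_euler_term_smul_mem_fil ha hv k)

theorem mem_fil_zero_of_mem_fil_succ {n : ℕ} (hv : v ∈ W.fil M (n + 1 : ℕ) (n + 2)) :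
    v ∈ W.fil M n 0 := by
  intro w hw h
  have hlen : (w.length : ℤ) ≤ (w.map Prod.fst).sum := by
    simpa using List.card_nsmul_le_sum (w.map Prod.fst) 1 (by
      intro d hd
      obtain ⟨b, hb, rfl⟩ := List.mem_map.1 hd
      exact (hw b hb).1)
  exact hv w hw (by omega)

section Polynomial

open Polynomial

variable [CharZero K]

theorem aeval_euler_smul_mem_fil (hl : l ≠ 0) (hv : v ∈ W.fil M p l) :
    aeval W.euler (1 - C (l : K)⁻¹ * X) • v ∈ W.fil M p (l + 1) := by
  have hl' : (l : K) ≠ 0 := Nat.cast_ne_zero.2 hl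
  have h := algebraMap_smul_mem_fil (-(l : K)⁻¹) (euler_sub_smul_mem_fil hv)
  convert h using 1
  rw [smul_smul, mul_sub, ← map_natCast (algebraMap K (UniversalEnvelopingAlgebra K 𝔤)) l,
    ← map_mul, neg_mul, inv_mul_cancel₀ hl']
  simp only [map_sub, map_one, map_mul, aeval_C, aeval_X, map_neg]
  noncomm_ring

theorem exists_aeval_euler_smul_mem_fil_succ (hp : 0 < p) (hv : v ∈ W.fil M p 0) (l : ℕ) :
    ∃ P : K[X], P.coeff 0 = 1 ∧ aeval W.euler P • v ∈ W.fil M p (l + 1) := by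
  induction l with
  | zero =>
    refine ⟨1, by simp, ?_⟩
    rw [map_one, one_smul]
    exact mem_fil_of_shift_smul_mem hp fun i a ha => shift_smul_mem_fil_sub (l := 0) ha hv
  | succ l ih =>
    obtain ⟨P, hP, hPv⟩ := ih
    refine ⟨(1 - C ((l + 1 : ℕ) : K)⁻¹ * X) * P, by simp [mul_coeff_zero, hP], ?_⟩
    rw [map_mul, mul_smul]
    exact aeval_euler_smul_mem_fil l.succ_ne_zero hPv

theorem exists_aeval_euler_smul_mem_fil_zero {n : ℕ} (hv : v ∈ W.fil M n 0) :
    ∃ P : K[X], P.coeff 0 = 1 ∧ aeval W.euler P • v ∈ W.fil M 0 0 := by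
  induction n generalizing v with
  | zero => exact ⟨1, by simp, by simpa using hv⟩
  | succ n ih =>
    obtain ⟨P, hP, hPv⟩ := exists_aeval_euler_smul_mem_fil_succ (by positivity) hv (n + 1)
    obtain ⟨R, hR, hRv⟩ := ih (mem_fil_zero_of_mem_fil_succ hPv)
    exact ⟨R * P, by simp [mul_coeff_zero, hP, hR], by rwa [map_mul, mul_smul]⟩

end Polynomial

theorem exists_add_mem_fil {v' : M} (hv : ∃ n : ℕ, v ∈ W.fil M n 0)
    (hv' : ∃ n : ℕ, v' ∈ W.fil M n 0) : ∃ n : ℕ, v + v' ∈ W.fil M n 0 := by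
  obtain ⟨n, hn⟩ := hv
  obtain ⟨n', hn'⟩ := hv'
  exact ⟨max n n', add_mem (fil_mono (by omega) hn) (fil_mono (by omega) hn')⟩

theorem exists_ι_smul_mem_fil (a : 𝔤) {n : ℕ} (hv : v ∈ W.fil M n 0) :
    ∃ m : ℕ, ι K a • v ∈ W.fil M m 0 := by
  induction (W.iSup_eq_top ▸ Submodule.mem_top : a ∈ ⨆ i, W.Γ i) using
    Submodule.iSup_induction' with
  | zero => exact ⟨0, by simp⟩
  | add a b _ _ ha hb =>
    rw [map_add, add_smul]
    exact exists_add_mem_fil ha hb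
  | mem i a ha =>
    rw [W.ι_eq_shift_add, add_smul]
    refine exists_add_mem_fil ⟨(n + (2 - i)).toNat + 1, ?_⟩ ⟨n, algebraMap_smul_mem_fil _ hv⟩
    have := shift_smul_mem_fil_add (d := 2 - i) (by simpa using ha) hv
    exact fil_mono (by omega) this

theorem exists_smul_mem_fil (u : UniversalEnvelopingAlgebra K 𝔤) {n : ℕ} (hv : v ∈ W.fil M n 0) :
    ∃ m : ℕ, u • v ∈ W.fil M m 0 := by
  have hu : u ∈ Algebra.adjoin K (Set.range (ι K : 𝔤 → UniversalEnvelopingAlgebra K 𝔤)) :=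
    (adjoin_range_ι (K := K) (𝔤 := 𝔤)).symm ▸ Algebra.mem_top
  induction hu using Algebra.adjoin_induction generalizing n v with
  | algebraMap c => exact ⟨n, algebraMap_smul_mem_fil c hv⟩
  | add x y _ _ hx hy => exact add_smul x y v ▸ exists_add_mem_fil (hx hv) (hy hv)
  | mul x y _ _ hx hy =>
    obtain ⟨m, hm⟩ := hy hv
    exact mul_smul x y v ▸ hx hm
  | mem x hx =>
    obtain ⟨a, rfl⟩ := hx
    exact exists_ι_smul_mem_fil a hv

theorem mem_fil_zero_zero_iff : v ∈ W.fil M 0 0 ↔ ∀ a ∈ W.𝔪, W.shift a • v = 0 := by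
  constructor
  · intro hv a ha
    refine Submodule.iSup_induction _ (motive := fun a => W.shift a • v = 0) (W.𝔪_le ha)
      (fun i b hb => ?_) (by simp) fun b c hb hc => by rw [map_add, add_smul, hb, hc, add_zero]
    by_cases hi : 1 ≤ i
    · rw [iSup_pos hi] at hb
      exact eq_zero_of_mem_fil (by omega) (shift_smul_mem_fil_sub ⟨hi, hb.1, hb.2⟩ hv)
    · rw [iSup_neg hi, Submodule.mem_bot] at hb
      rw [hb, map_zero, zero_smul]
  · intro h w hw hw'
    induction w using List.reverseRecOn with
    | nil => simp at hw'
    | append_singleton w b _ => simp [mul_smul, h b.2 (hw b (by simp)).2.1]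

variable (W) in
open Polynomial in
theorem exists_aeval_euler_mul_smul [CharZero K] (hv : ∀ a ∈ W.𝔪, W.shift a • v = 0)
    (u : UniversalEnvelopingAlgebra K 𝔤) :
    ∃ P : K[X], P.coeff 0 = 1 ∧ ∀ a ∈ W.𝔪, W.shift a • (aeval W.euler P * u) • v = 0 := by
  obtain ⟨n, hn⟩ := exists_smul_mem_fil u (n := 0) (mem_fil_zero_zero_iff.2 hv)
  obtain ⟨P, hP, h⟩ := exists_aeval_euler_smul_mem_fil_zero hn
  refine ⟨P, hP, mem_fil_zero_zero_iff.1 ?_⟩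
  rwa [mul_smul]

end WhittakerGrading

end Whittaker

/-! ### Reduction by stages -/

namespace QuantumReduction

open Polynomial

variable {A : Type*} [Ring A] [Algebra ℂ A]

theorem aeval_mul_sub_mem {J : Ideal A} {E X : A} (h : E * X ∈ J) {P : ℂ[X]}
    (hP : P.coeff 0 = 1) : aeval E P * X - X ∈ J := by
  have hfactor : aeval E P * X - X = aeval E P.divX * (E * X) := by
    conv_lhs => rw [← P.divX_mul_X_add, hP]
    simp only [map_add, map_mul, aeval_X, map_one]
    noncomm_ring
  rw [hfactor]
  exact J.mul_mem_left _ h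

section Euler

variable {𝔪 : Type*} [LieRing 𝔪] [LieAlgebra ℂ 𝔪] {φ : 𝔪 →ₗ⁅ℂ⁆ A} {χ : 𝔪 →ₗ[ℂ] ℂ} {E X Y : A}

theorem toQ_eq_zero_iff : toQ φ χ X = 0 ↔ X ∈ leftIdeal φ χ :=
  Submodule.Quotient.mk_eq_zero _

theorem mul_mem_leftIdeal (hY : Y ∈ leftIdeal φ χ) (hX : toQ φ χ X ∈ invariants φ χ) :
    Y * X ∈ leftIdeal φ χ := by
  have h := rightMul_toQ Y X hX
  rw [toQ_eq_zero_iff.2 hY, map_zero] at h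
  exact toQ_eq_zero_iff.1 h.symm

theorem coe_mul_eq_toQ {a b : invariants φ χ} (ha : (a : Q φ χ) = toQ φ χ X)
    (hb : (b : Q φ χ) = toQ φ χ Y) : ((a * b : invariants φ χ) : Q φ χ) = toQ φ χ (X * Y) := by
  obtain ⟨_, _⟩ := a
  obtain ⟨_, _⟩ := b
  subst ha hb
  rfl

theorem coe_lie_eq_toQ {a b : invariants φ χ} (ha : (a : Q φ χ) = toQ φ χ X)
    (hb : (b : Q φ χ) = toQ φ χ Y) : ((⁅a, b⁆ : invariants φ χ) : Q φ χ) = toQ φ χ ⁅X, Y⁆ := by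
  rw [LieRing.of_associative_ring_bracket, LieRing.of_associative_ring_bracket,
    Submodule.coe_sub, coe_mul_eq_toQ ha hb, coe_mul_eq_toQ hb ha]
  rfl

theorem toQ_aeval_mul (hE : E ∈ leftIdeal φ χ) (hX : toQ φ χ X ∈ invariants φ χ) {P : ℂ[X]}
    (hP : P.coeff 0 = 1) : toQ φ χ (aeval E P * X) = toQ φ χ X :=
  (Submodule.Quotient.eq _).2 (aeval_mul_sub_mem (mul_mem_leftIdeal hE hX) hP)

variable (φ χ E) in
/-- An element of the left ideal, hence annihilating all invariant classes, such that every class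
becomes invariant after multiplication by a suitable polynomial in it. For an Euler operator this
polynomial is a product of factors `1 - E / l` that kill the components of positive degree. -/
structure IsEuler : Prop where
  mem_leftIdeal : E ∈ leftIdeal φ χ
  exists_aeval_mul_mem : ∀ u : A,
    ∃ P : ℂ[X], P.coeff 0 = 1 ∧ toQ φ χ (aeval E P * u) ∈ invariants φ χ

end Euler

variable {𝔪₁ 𝔪₂ 𝔪₀ : Type*} [LieRing 𝔪₁] [LieAlgebra ℂ 𝔪₁] [LieRing 𝔪₂] [LieAlgebra ℂ 𝔪₂]
  [LieRing 𝔪₀] [LieAlgebra ℂ 𝔪₀]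
  {φ₁ : 𝔪₁ →ₗ⁅ℂ⁆ A} {χ₁ : 𝔪₁ →ₗ[ℂ] ℂ} {φ₂ : 𝔪₂ →ₗ⁅ℂ⁆ A} {χ₂ : 𝔪₂ →ₗ[ℂ] ℂ}
  {j : 𝔪₀ →ₗ⁅ℂ⁆ invariants φ₁ χ₁} {χ₀ : 𝔪₀ →ₗ[ℂ] ℂ} {i₁ : 𝔪₁ → 𝔪₂} {i₀ : 𝔪₀ → 𝔪₂}

theorem exists_rep_rep (a : invariants j χ₀) :
    ∃ (X : A) (hX : toQ φ₁ χ₁ X ∈ invariants φ₁ χ₁)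
      (hX₀ : toQ j χ₀ ⟨toQ φ₁ χ₁ X, hX⟩ ∈ invariants j χ₀), a = ⟨_, hX₀⟩ := by
  obtain ⟨b, hb, rfl⟩ := exists_rep a
  obtain ⟨X, hX, rfl⟩ := exists_rep b
  exact ⟨X, hX, hb, rfl⟩

variable (φ₁ χ₁ φ₂ χ₂ j χ₀ i₁ i₀) in
/-- The data of a reduction in two stages: `𝔪₂` is the sum of the images of `𝔪₁` and `𝔪₀`, and the
maps to `A` and the linear forms are compatible. -/
structure IsStages : Prop where
  φ₂_i₁ : ∀ y, φ₂ (i₁ y) = φ₁ y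
  χ₂_i₁ : ∀ y, χ₂ (i₁ y) = χ₁ y
  coe_j : ∀ y, (j y : Q φ₁ χ₁) = toQ φ₁ χ₁ (φ₂ (i₀ y))
  χ₂_i₀ : ∀ y, χ₂ (i₀ y) = χ₀ y
  exists_eq_add : ∀ y, ∃ y₁ y₀, y = i₁ y₁ + i₀ y₀

namespace IsStages

variable (h : IsStages φ₁ χ₁ φ₂ χ₂ j χ₀ i₁ i₀) {X : A}

include h

theorem leftIdeal_le : leftIdeal φ₁ χ₁ ≤ leftIdeal φ₂ χ₂ := by
  refine Submodule.span_le.2 ?_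
  rintro _ ⟨y, rfl⟩
  simp only [← h.φ₂_i₁, ← h.χ₂_i₁]
  exact gen_mem _

theorem coe_j_sub (y : 𝔪₀) :
    ((j y - algebraMap ℂ (invariants φ₁ χ₁) (χ₀ y) : invariants φ₁ χ₁) : Q φ₁ χ₁)
      = toQ φ₁ χ₁ (φ₂ (i₀ y) - algebraMap ℂ A (χ₂ (i₀ y))) := by
  rw [Submodule.coe_sub, h.coe_j, h.χ₂_i₀, Algebra.algebraMap_eq_smul_one,
    Algebra.algebraMap_eq_smul_one]
  rfl

theorem mapQ_eq_zero {a : invariants φ₁ χ₁} (ha : a ∈ leftIdeal j χ₀) :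
    Submodule.mapQ _ (leftIdeal φ₂ χ₂) LinearMap.id h.leftIdeal_le (a : Q φ₁ χ₁) = 0 := by
  induction ha using Submodule.closure_induction with
  | zero => simp
  | add a b _ _ ha hb => rw [Submodule.coe_add, map_add, ha, hb, add_zero]
  | smul_mem b a ha =>
    obtain ⟨y, rfl⟩ := ha
    obtain ⟨Y, hY, rfl⟩ := exists_rep b
    rw [smul_eq_mul, coe_mul_eq_toQ (X := Y) rfl (h.coe_j_sub y)]
    exact toQ_eq_zero_iff.2 (Ideal.mul_mem_left _ _ (gen_mem _))

theorem mem_leftIdeal_of_coe_eq {a : invariants φ₁ χ₁} (ha : a ∈ leftIdeal j χ₀)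
    (hX : (a : Q φ₁ χ₁) = toQ φ₁ χ₁ X) : X ∈ leftIdeal φ₂ χ₂ :=
  toQ_eq_zero_iff.1 ((congrArg _ hX).symm.trans (h.mapQ_eq_zero ha))

theorem toQ_mem_invariants {hX : toQ φ₁ χ₁ X ∈ invariants φ₁ χ₁}
    (hX₀ : toQ j χ₀ ⟨toQ φ₁ χ₁ X, hX⟩ ∈ invariants j χ₀) :
    toQ φ₂ χ₂ X ∈ invariants φ₂ χ₂ := by
  refine (toQ_mem_invariants_iff X).2 fun y => ?_
  obtain ⟨y₁, y₀, rfl⟩ := h.exists_eq_add y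
  rw [map_add, add_lie, h.φ₂_i₁]
  exact add_mem (h.leftIdeal_le ((toQ_mem_invariants_iff X).1 hX y₁))
    (h.mem_leftIdeal_of_coe_eq ((toQ_mem_invariants_iff _).1 hX₀ y₀)
      (coe_lie_eq_toQ (h.coe_j y₀) rfl))

/-- The natural map from the quotient of the first reduction by the ideal of the second stage to
the one-stage quotient. -/
def quotientMap : Q j χ₀ →+ Q φ₂ χ₂ :=
  QuotientAddGroup.lift (leftIdeal j χ₀).toAddSubgroup
    ((Submodule.mapQ _ (leftIdeal φ₂ χ₂) LinearMap.id h.leftIdeal_le).toAddMonoidHom.comp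
      (invariants φ₁ χ₁).subtype.toAddMonoidHom)
    fun _ ha => h.mapQ_eq_zero ha

theorem quotientMap_mem_invariants (a : invariants j χ₀) :
    h.quotientMap a ∈ invariants φ₂ χ₂ := by
  obtain ⟨X, hX, hX₀, rfl⟩ := exists_rep_rep a
  exact h.toQ_mem_invariants hX₀

/-- The comparison map from the reduction in two stages to the reduction in one stage. -/
def comparison : invariants j χ₀ →ₐ[ℂ] invariants φ₂ χ₂ :=
  let Θ : invariants j χ₀ →ₗ[ℂ] invariants φ₂ χ₂ :=
    { toFun := fun a => ⟨h.quotientMap a, h.quotientMap_mem_invariants a⟩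
      map_add' := fun a b => Subtype.ext (map_add h.quotientMap (a : Q j χ₀) b)
      map_smul' := fun c a => by
        obtain ⟨X, hX, hX₀, rfl⟩ := exists_rep_rep a
        rfl }
  AlgHom.ofLinearMap Θ rfl fun a b => by
    obtain ⟨X, hX, hX₀, rfl⟩ := exists_rep_rep a
    obtain ⟨Y, hY, hY₀, rfl⟩ := exists_rep_rep b
    rfl

theorem coe_comparison {hX : toQ φ₁ χ₁ X ∈ invariants φ₁ χ₁}
    (hX₀ : toQ j χ₀ ⟨toQ φ₁ χ₁ X, hX⟩ ∈ invariants j χ₀) :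
    (h.comparison ⟨toQ j χ₀ ⟨toQ φ₁ χ₁ X, hX⟩, hX₀⟩ : Q φ₂ χ₂) = toQ φ₂ χ₂ X := rfl

variable {E : A} (hE : IsEuler φ₁ χ₁ E)

include hE

theorem exists_aeval_mul_smul_gen (u : A) (y : 𝔪₂) :
    ∃ P : ℂ[X], P.coeff 0 = 1 ∧ ∃ a ∈ leftIdeal j χ₀,
      (a : Q φ₁ χ₁) = toQ φ₁ χ₁ (aeval E P * (u * (φ₂ y - algebraMap ℂ A (χ₂ y)))) := by
  obtain ⟨y₁, y₀, rfl⟩ := h.exists_eq_add y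
  obtain ⟨P, hP, hu⟩ := hE.exists_aeval_mul_mem u
  refine ⟨P, hP, ⟨_, hu⟩ * (j y₀ - algebraMap ℂ _ (χ₀ y₀)),
    Ideal.mul_mem_left _ _ (gen_mem y₀), ?_⟩
  rw [coe_mul_eq_toQ rfl (h.coe_j_sub y₀)]
  refine ((Submodule.Quotient.eq _).2 ?_).symm
  have hdiff : aeval E P * (u * (φ₂ (i₁ y₁ + i₀ y₀) - algebraMap ℂ A (χ₂ (i₁ y₁ + i₀ y₀))))
      - aeval E P * u * (φ₂ (i₀ y₀) - algebraMap ℂ A (χ₂ (i₀ y₀)))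
      = aeval E P * u * (φ₁ y₁ - algebraMap ℂ A (χ₁ y₁)) := by
    rw [← h.φ₂_i₁, ← h.χ₂_i₁]
    simp only [map_add]
    noncomm_ring
  rw [hdiff]
  exact Ideal.mul_mem_left _ _ (gen_mem _)

theorem exists_aeval_mul_mem_leftIdeal (hX : X ∈ leftIdeal φ₂ χ₂) :
    ∃ P : ℂ[X], P.coeff 0 = 1 ∧ ∃ a ∈ leftIdeal j χ₀,
      (a : Q φ₁ χ₁) = toQ φ₁ χ₁ (aeval E P * X) := by
  have enlarge {Y : A} {P : ℂ[X]} {a : invariants φ₁ χ₁} {R : ℂ[X]} (hR : R.coeff 0 = 1)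
      (ha : (a : Q φ₁ χ₁) = toQ φ₁ χ₁ (aeval E P * Y)) :
      (a : Q φ₁ χ₁) = toQ φ₁ χ₁ (aeval E (R * P) * Y) := by
    rw [ha, map_mul, mul_assoc, toQ_aeval_mul hE.mem_leftIdeal (ha ▸ a.2) hR]
  induction hX using Submodule.closure_induction with
  | zero => exact ⟨1, by simp, 0, zero_mem _, by simp⟩
  | add X Y _ _ hX hY =>
    obtain ⟨P, hP, a, ha, haX⟩ := hX
    obtain ⟨R, hR, b, hb, hbY⟩ := hY
    refine ⟨R * P, by simp [mul_coeff_zero, hP, hR], a + b, add_mem ha hb, ?_⟩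
    rw [Submodule.coe_add, enlarge hR haX, enlarge hP hbY, mul_comm P R, mul_add]
    rfl
  | smul_mem u X hX =>
    obtain ⟨y, rfl⟩ := hX
    exact h.exists_aeval_mul_smul_gen hE u y

theorem mem_leftIdeal_iff {a : invariants φ₁ χ₁} (ha : (a : Q φ₁ χ₁) = toQ φ₁ χ₁ X) :
    a ∈ leftIdeal j χ₀ ↔ X ∈ leftIdeal φ₂ χ₂ := by
  refine ⟨fun ha' => h.mem_leftIdeal_of_coe_eq ha' ha, fun hX => ?_⟩
  obtain ⟨P, hP, b, hb, hbX⟩ := h.exists_aeval_mul_mem_leftIdeal hE hX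
  rw [toQ_aeval_mul hE.mem_leftIdeal (ha ▸ a.2) hP, ← ha] at hbX
  rwa [← Subtype.ext hbX]

theorem toQ_mk_mem_invariants (hX : toQ φ₁ χ₁ X ∈ invariants φ₁ χ₁)
    (hX₂ : toQ φ₂ χ₂ X ∈ invariants φ₂ χ₂) :
    toQ j χ₀ ⟨toQ φ₁ χ₁ X, hX⟩ ∈ invariants j χ₀ :=
  (toQ_mem_invariants_iff _).2 fun y =>
    (h.mem_leftIdeal_iff hE (coe_lie_eq_toQ (h.coe_j y) rfl)).2
      ((toQ_mem_invariants_iff X).1 hX₂ (i₀ y))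

theorem exists_toQ_mem_invariants (hX : toQ φ₂ χ₂ X ∈ invariants φ₂ χ₂) :
    ∃ Y : A, toQ φ₁ χ₁ Y ∈ invariants φ₁ χ₁ ∧ toQ φ₂ χ₂ Y = toQ φ₂ χ₂ X := by
  obtain ⟨P, hP, hPX⟩ := hE.exists_aeval_mul_mem X
  exact ⟨_, hPX, toQ_aeval_mul (h.leftIdeal_le hE.mem_leftIdeal) hX hP⟩

theorem comparison_bijective : Function.Bijective h.comparison := by
  refine ⟨(injective_iff_map_eq_zero h.comparison).2 fun a ha => ?_, fun b => ?_⟩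
  · obtain ⟨X, hX, hX₀, rfl⟩ := exists_rep_rep a
    have hX₂ : toQ φ₂ χ₂ X = 0 := congrArg Subtype.val ha
    exact Subtype.ext
      (toQ_eq_zero_iff.2 ((h.mem_leftIdeal_iff hE rfl).2 (toQ_eq_zero_iff.1 hX₂)))
  · obtain ⟨X, hX, rfl⟩ := exists_rep b
    obtain ⟨Y, hY, hYX⟩ := h.exists_toQ_mem_invariants hE hX
    exact ⟨⟨toQ j χ₀ ⟨_, hY⟩, h.toQ_mk_mem_invariants hE hY (hYX ▸ hX)⟩, Subtype.ext hYX⟩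

end IsStages

end QuantumReduction

/-! ### Good algebras -/

namespace FiniteW

open QuantumReduction UniversalEnvelopingAlgebra

variable {𝔤 : Type*} [LieRing 𝔤] [LieAlgebra ℂ 𝔤] {B : LinearMap.BilinForm ℂ 𝔤}
  {Γ : ℤ → Submodule ℂ 𝔤} {f q a b : 𝔤} {i j : ℤ} {𝔪 : LieSubalgebra ℂ 𝔤}

theorem IsGradingElement.form_eq_zero (hq : IsGradingElement Γ q) (hB : B.lieInvariant 𝔤)
    (ha : a ∈ Γ i) (hb : b ∈ Γ j) (hij : i + j ≠ 0) : B a b = 0 := by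
  have h := hB q a b
  rw [(hq i a).1 ha, (hq j b).1 hb] at h
  simp only [map_smul, LinearMap.smul_apply, smul_eq_mul] at h
  have hmul : ((i + j : ℤ) : ℂ) * B a b = 0 := by push_cast; linear_combination h
  exact (mul_eq_zero.1 hmul).resolve_left (by exact_mod_cast hij)

theorem IsGradingElement.chi_eq_zero (hq : IsGradingElement Γ q) (hB : B.lieInvariant 𝔤)
    (hf : f ∈ Γ (-2)) (ha : a ∈ Γ i) (hi : i ≠ 2) : chi B f a = 0 :=
  hq.form_eq_zero hB hf ha (by omega)

theorem chi_lie_comm_eq_zero_iff : chi B f ⁅a, b⁆ = 0 ↔ chi B f ⁅b, a⁆ = 0 := by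
  rw [← lie_skew, map_neg, neg_eq_zero]

namespace IsGoodGrading

variable (hΓ : IsGoodGrading Γ f) (hq : IsGradingElement Γ q) (hB : B.lieInvariant 𝔤)

include hΓ hq hB

theorem chi_lie_eq_zero_of_mem_iSup (ha : a ∈ ⨆ (i : ℤ) (_ : 1 ≤ i), Γ i)
    (hb : b ∈ ⨆ (i : ℤ) (_ : 2 ≤ i), Γ i) : chi B f ⁅a, b⁆ = 0 := by
  refine (iSup₂_le (a := LinearMap.ker ((chi B f).comp (LieAlgebra.ad ℂ 𝔤 a))) ?_) hb
  intro j hj b hb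
  change chi B f ⁅a, b⁆ = 0
  rw [chi_lie_comm_eq_zero_iff]
  refine (iSup₂_le (a := LinearMap.ker ((chi B f).comp (LieAlgebra.ad ℂ 𝔤 b))) ?_) ha
  intro i hi a ha
  exact hq.chi_eq_zero hB hΓ.mem_neg_two (hΓ.lie_mem j i b hb a ha) (by omega)

theorem eq_zero_of_chi_lie_eq_zero (hB' : B.Nondegenerate) (hi : 1 ≤ i) (ha : a ∈ Γ i)
    (h : ∀ x ∈ Γ (2 - i), chi B f ⁅a, x⁆ = 0) : a = 0 := by
  refine hΓ.injective i hi a ha (hB'.1 _ fun y => ?_)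
  have hy : y ∈ ⨆ j, Γ j := hΓ.isInternal.submodule_iSup_eq_top ▸ Submodule.mem_top
  refine (iSup_le (a := LinearMap.ker (B ⁅f, a⁆)) ?_) hy
  intro j y hy
  rw [LinearMap.mem_ker]
  by_cases hj : j = 2 - i
  · have hinv : B ⁅a, f⁆ y = -chi B f ⁅a, y⁆ := hB a f y
    rw [← lie_skew, map_neg, LinearMap.neg_apply, hinv, h y (hj ▸ hy), neg_zero, neg_zero]
  · exact hq.form_eq_zero hB (hΓ.lie_mem _ _ f hΓ.mem_neg_two _ ha) hy (by omega)

theorem exists_dual [FiniteDimensional ℂ 𝔤] (hB' : B.Nondegenerate) (hi : 1 ≤ i)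
    {N : Submodule ℂ 𝔤} (hN : N ≤ Γ i) :
    ∃ z x : Fin (Module.finrank ℂ N) → 𝔤, (∀ k, z k ∈ N) ∧ (∀ k, x k ∈ Γ (2 - i)) ∧
      ∀ a ∈ N, ∑ k, chi B f ⁅a, x k⁆ • z k = a := by
  let basis := Module.finBasis ℂ N
  let pairing : N →ₗ[ℂ] Γ (2 - i) →ₗ[ℂ] ℂ :=
    LinearMap.mk₂ ℂ (fun a x => chi B f ⁅(a : 𝔤), (x : 𝔤)⁆) (by simp) (by simp) (by simp) (by simp)
  have hpairing : Function.Injective pairing :=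
    (injective_iff_map_eq_zero pairing).2 fun a ha =>
      Subtype.ext (hΓ.eq_zero_of_chi_lie_eq_zero hq hB hB' hi (hN a.2) fun x hx =>
        LinearMap.congr_fun ha ⟨x, hx⟩)
  choose x hx using fun k => LinearMap.flip_surjective_iff₁.2 hpairing (basis.coord k)
  refine ⟨fun k => basis k, fun k => x k, fun k => (basis k).2, fun k => (x k).2, fun a ha => ?_⟩
  have hcoord : ∀ k, chi B f ⁅a, (x k : 𝔤)⁆ = basis.repr ⟨a, ha⟩ k := fun k =>
    LinearMap.congr_fun (hx k) ⟨a, ha⟩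
  simpa only [hcoord, map_sum, map_smul, Submodule.subtype_apply] using
    congrArg N.subtype (basis.sum_repr ⟨a, ha⟩)

theorem exists_dual_family [FiniteDimensional ℂ 𝔤] (hB' : B.Nondegenerate) (N : Submodule ℂ 𝔤) :
    ∃ (κ : Type) (_ : Fintype κ) (deg : κ → ℤ) (z x : κ → 𝔤), (∀ k, 1 ≤ deg k) ∧
      (∀ k, z k ∈ N ⊓ Γ (deg k)) ∧ (∀ k, x k ∈ Γ (2 - deg k)) ∧
      ∀ i, 1 ≤ i → ∀ a ∈ N ⊓ Γ i, ∑ k, chi B f ⁅a, x k⁆ • z k = a := by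
  have hfin : {i | Γ i ≠ ⊥}.Finite :=
    WellFoundedGT.finite_ne_bot_of_iSupIndep hΓ.isInternal.submodule_iSupIndep
  let S : Finset ℤ := hfin.toFinset.filter (1 ≤ ·)
  have hS : ∀ i : S, 1 ≤ (i : ℤ) := fun i => (Finset.mem_filter.1 i.2).2
  choose z x hz hx hdual using fun i : S =>
    hΓ.exists_dual hq hB hB' (hS i) (inf_le_right : N ⊓ Γ i ≤ Γ i)
  refine ⟨(j : S) × Fin (Module.finrank ℂ ↥(N ⊓ Γ j)), inferInstance, fun k => k.1,
    fun k => z k.1 k.2, fun k => x k.1 k.2, fun k => hS k.1, fun k => hz k.1 k.2,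
    fun k => hx k.1 k.2, fun i hi a ha => ?_⟩
  rw [Fintype.sum_sigma]
  by_cases hbot : Γ i = ⊥
  · have ha₀ : a = 0 := (Submodule.mem_bot ℂ).1 (hbot ▸ ha.2)
    simp [ha₀]
  have hiS : i ∈ S := Finset.mem_filter.2 ⟨hfin.mem_toFinset.2 hbot, hi⟩
  rw [Finset.sum_eq_single (⟨i, hiS⟩ : S) (fun j _ hj => ?_) (by simp)]
  · exact hdual ⟨i, hiS⟩ a ha
  refine Finset.sum_eq_zero fun k _ => ?_
  have hne : (j : ℤ) ≠ i := fun h => hj (Subtype.ext h)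
  rw [hq.chi_eq_zero hB hΓ.mem_neg_two (hΓ.lie_mem _ _ _ ha.2 _ (hx j k)) (by omega), zero_smul]

end IsGoodGrading

namespace IsGoodAlgebra

variable (h𝔪 : IsGoodAlgebra B Γ f 𝔪)

include h𝔪

theorem mem_of_mem (hi : 2 ≤ i) (ha : a ∈ Γ i) : a ∈ 𝔪 := by
  obtain ⟨𝔩, -, h⟩ := h𝔪
  exact (h ▸ le_sup_of_le_right (le_iSup₂_of_le i hi le_rfl) : Γ i ≤ 𝔪.toSubmodule) ha

theorem le_iSup_inf : 𝔪.toSubmodule ≤ ⨆ (i : ℤ) (_ : 1 ≤ i), 𝔪.toSubmodule ⊓ Γ i := by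
  obtain ⟨𝔩, h𝔩, h⟩ := h𝔪
  conv_lhs => rw [h]
  refine sup_le ?_ (iSup₂_le fun i hi => ?_)
  · refine le_iSup₂_of_le 1 le_rfl (le_inf ?_ fun a ha => ((h𝔩 a).1 ha).1)
    rw [h]
    exact le_sup_left
  · refine le_iSup₂_of_le i (by omega) (le_inf ?_ le_rfl)
    rw [h]
    exact le_sup_of_le_right (le_iSup₂_of_le i hi le_rfl)

theorem le_iSup : 𝔪.toSubmodule ≤ ⨆ (i : ℤ) (_ : 1 ≤ i), Γ i :=
  h𝔪.le_iSup_inf.trans (iSup₂_mono fun _ _ => inf_le_right)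

theorem chi_eq_of_sub_mem (hq : IsGradingElement Γ q) (hB : B.lieInvariant 𝔤) {f' : 𝔤}
    (hf' : f' - f ∈ Γ 0) (ha : a ∈ 𝔪) : chi B f' a = chi B f a := by
  rw [← sub_eq_zero, ← LinearMap.sub_apply, ← map_sub]
  refine (iSup₂_le (a := LinearMap.ker (B (f' - f))) ?_) (h𝔪.le_iSup ha)
  exact fun i hi b hb => hq.form_eq_zero hB hf' hb (by omega)

variable (hΓ : IsGoodGrading Γ f) (hq : IsGradingElement Γ q) (hB : B.lieInvariant 𝔤)

include hΓ hq hB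

theorem chi_lie (ha : a ∈ 𝔪) (hb : b ∈ 𝔪) : chi B f ⁅a, b⁆ = 0 := by
  have hle := h𝔪.le_iSup
  obtain ⟨𝔩, h𝔩, h⟩ := h𝔪
  obtain ⟨l, hl, r, hr, rfl⟩ := Submodule.mem_sup.1 (h.le ha)
  obtain ⟨l', hl', r', hr', rfl⟩ := Submodule.mem_sup.1 (h.le hb)
  have hlr' := hΓ.chi_lie_eq_zero_of_mem_iSup hq hB (hle (h.ge (Submodule.mem_sup_left hl))) hr'
  have hbr := hΓ.chi_lie_eq_zero_of_mem_iSup hq hB (hle hb) hr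
  rw [add_lie, map_add, chi_lie_comm_eq_zero_iff.2 hbr, lie_add, map_add, ((h𝔩 l).1 hl).2 l' hl',
    hlr', add_zero, add_zero]

variable [FiniteDimensional ℂ 𝔤] (hB' : B.Nondegenerate)

include hB'

theorem exists_whittakerGrading :
    ∃ (κ : Type) (_ : Fintype κ) (W : WhittakerGrading ℂ 𝔤 κ), W.χ = chi B f ∧ W.𝔪 = 𝔪 := by
  obtain ⟨κ, hκ, deg, z, x, hdeg, hz, hx, hdual⟩ :=
    hΓ.exists_dual_family hq hB hB' 𝔪.toSubmodule
  exact ⟨κ, hκ,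
    { Γ := Γ
      χ := chi B f
      𝔪 := 𝔪
      deg := deg
      z := z
      x := x
      iSup_eq_top := hΓ.isInternal.submodule_iSup_eq_top
      lie_mem := fun ha hb => hΓ.lie_mem _ _ _ ha _ hb
      χ_eq_zero := fun ha hi => hq.chi_eq_zero hB hΓ.mem_neg_two ha hi
      χ_lie := fun ha hb => h𝔪.chi_lie hΓ hq hB ha hb
      mem_𝔪 := fun hi ha => h𝔪.mem_of_mem hi ha
      𝔪_le := h𝔪.le_iSup_inf
      one_le_deg := hdeg
      z_mem_𝔪 := fun k => (hz k).1
      z_mem_Γ := fun k => (hz k).2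
      x_mem_Γ := hx
      sum_χ_lie_x_smul_z := fun hi ha ha' => hdual _ hi _ ⟨ha, ha'⟩ }, rfl, rfl⟩

theorem exists_isEuler : ∃ E, IsEuler (toU 𝔪) (chiOn B f 𝔪) E := by
  obtain ⟨κ, _, W, hχ, rfl⟩ := h𝔪.exists_whittakerGrading hΓ hq hB hB'
  have hshift : ∀ a ∈ W.𝔪, W.shift a ∈ leftIdeal (toU W.𝔪) (chiOn B f W.𝔪) := fun a ha => by
    rw [W.shift_apply, hχ]
    exact gen_mem (φ := toU W.𝔪) (χ := chiOn B f W.𝔪) ⟨a, ha⟩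
  refine ⟨W.euler, sum_mem fun k _ => Ideal.mul_mem_left _ _ (hshift _ (W.z_mem_𝔪 k)), fun u => ?_⟩
  obtain ⟨P, hP, h⟩ := W.exists_aeval_euler_mul_smul (v := toGG B f W.𝔪 1)
    (fun a ha => toQ_eq_zero_iff.2 (by simpa using hshift a ha)) u
  refine ⟨P, hP, (toQ_mem_invariants_iff _).2 fun y => (lie_mem_iff y _).2 ?_⟩
  have hy : W.shift y * (Polynomial.aeval W.euler P * u * 1) ∈ leftIdeal _ _ :=
    toQ_eq_zero_iff.1 (h y y.2)
  rw [mul_one, W.shift_apply, hχ] at hy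
  exact hy

end IsGoodAlgebra

theorem toGG_ι_mem_WAlgebra {y : 𝔤} (hy : ∀ z ∈ 𝔪, ⁅z, y⁆ ∈ 𝔪)
    (hχ : ∀ z ∈ 𝔪, chi B f ⁅z, y⁆ = 0) : toGG B f 𝔪 (ι ℂ y) ∈ WAlgebra B f 𝔪 := by
  refine (toQ_mem_invariants_iff _).2 fun z => ?_
  have hgen := gen_mem (φ := toU 𝔪) (χ := chiOn B f 𝔪) ⟨_, hy z z.2⟩
  have hchi : chiOn B f 𝔪 ⟨_, hy z z.2⟩ = 0 := hχ z z.2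
  rw [hchi, map_zero, sub_zero] at hgen
  convert hgen using 1
  exact (LieHom.map_lie (ι ℂ) (z : 𝔤) y).symm

variable {𝔪₁ 𝔪₂ 𝔪₀ : LieSubalgebra ℂ 𝔤} {f₁ f₂ : 𝔤}

/-- The Lie algebra homomorphism `y ↦ y mod Î` from `𝔪₀` to the finite W-algebra, defined when
these classes are invariant under `ad 𝔪`. -/
def lieToWAlgebra (h : ∀ y : 𝔪₀, toGG B f 𝔪 (ι ℂ (y : 𝔤)) ∈ WAlgebra B f 𝔪) :
    𝔪₀ →ₗ⁅ℂ⁆ WAlgebra B f 𝔪 where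
  toFun y := ⟨_, h y⟩
  map_add' x y := Subtype.ext (congrArg (toGG B f 𝔪) (map_add (ι ℂ) (x : 𝔤) y))
  map_smul' c x := Subtype.ext (congrArg (toGG B f 𝔪) (map_smul (ι ℂ) c (x : 𝔤)))
  map_lie' {x y} := Subtype.ext <|
    (congrArg (toGG B f 𝔪) (LieHom.map_lie (ι ℂ) (x : 𝔤) y)).trans (coe_lie_eq_toQ rfl rfl).symm

theorem lieToWAlgebra_injective (V : Type*) [AddCommGroup V] [Module ℂ V] [FiniteDimensional ℂ V]
    [LieRingModule 𝔤 V] [LieModule ℂ 𝔤 V] [LieModule.IsFaithful ℂ 𝔤 V] [FiniteDimensional ℂ 𝔤]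
    (hχ : ∀ x ∈ 𝔪, ∀ y ∈ 𝔪, chi B f ⁅x, y⁆ = 0)
    (hdisj : Disjoint 𝔪.toSubmodule 𝔪₀.toSubmodule)
    (h : ∀ y : 𝔪₀, toGG B f 𝔪 (ι ℂ (y : 𝔤)) ∈ WAlgebra B f 𝔪) :
    Function.Injective (lieToWAlgebra h) := by
  refine (injective_iff_map_eq_zero _).2 fun y hy => ?_
  have hyI : ι ℂ (y : 𝔤) ∈ leftIdeal (toU 𝔪) (chiOn B f 𝔪) :=
    toQ_eq_zero_iff.1 (congrArg Subtype.val hy)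
  have hy𝔪 : (y : 𝔤) ∈ 𝔪 :=
    mem_of_ι_mem_ideal_span 𝔪 (chiOn B f 𝔪) V (fun a b => hχ a a.2 b b.2) hyI
  exact Subtype.ext (Submodule.disjoint_def.1 hdisj _ hy𝔪 y.2)

theorem isStages_lieToWAlgebra (h₁ : 𝔪₁ ≤ 𝔪₂) (h₀ : 𝔪₀ ≤ 𝔪₂)
    (hsup : 𝔪₂.toSubmodule ≤ 𝔪₁.toSubmodule ⊔ 𝔪₀.toSubmodule)
    (hχ : ∀ y ∈ 𝔪₁, chi B f₂ y = chi B f₁ y)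
    (h : ∀ y : 𝔪₀, toGG B f₁ 𝔪₁ (ι ℂ (y : 𝔤)) ∈ WAlgebra B f₁ 𝔪₁) :
    IsStages (toU 𝔪₁) (chiOn B f₁ 𝔪₁) (toU 𝔪₂) (chiOn B f₂ 𝔪₂) (lieToWAlgebra h)
      (chiOn B f₂ 𝔪₀) (LieSubalgebra.inclusion h₁) (LieSubalgebra.inclusion h₀) where
  φ₂_i₁ _ := rfl
  χ₂_i₁ y := hχ y y.2
  coe_j _ := rfl
  χ₂_i₀ _ := rfl
  exists_eq_add y := by
    obtain ⟨y₁, hy₁, y₀, hy₀, hy⟩ := Submodule.mem_sup.1 (hsup y.2)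
    exact ⟨⟨y₁, hy₁⟩, ⟨y₀, hy₀⟩, Subtype.ext hy.symm⟩

end FiniteW

end

theorem theorem3p6_general {𝔤 : Type*} [LieRing 𝔤] [LieAlgebra ℂ 𝔤] [FiniteDimensional ℂ 𝔤]
    (V : Type*) [AddCommGroup V] [Module ℂ V] [FiniteDimensional ℂ V] [LieRingModule 𝔤 V]
    [LieModule ℂ 𝔤 V] [LieModule.IsFaithful ℂ 𝔤 V]
    (B : LinearMap.BilinForm ℂ 𝔤) (hB_nondeg : B.Nondegenerate) (hB_inv : B.lieInvariant 𝔤)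
    (f₁ f₂ : 𝔤) (Γ₁ : ℤ → Submodule ℂ 𝔤) (hΓ₁ : FiniteW.IsGoodGrading Γ₁ f₁)
    (q₁ : 𝔤) (hq₁ : FiniteW.IsGradingElement Γ₁ q₁)
    (𝔪₁ 𝔪₂ 𝔪₀ : LieSubalgebra ℂ 𝔤) (h𝔪₁ : FiniteW.IsGoodAlgebra B Γ₁ f₁ 𝔪₁)
    (h_sup : 𝔪₂.toSubmodule = 𝔪₁.toSubmodule ⊔ 𝔪₀.toSubmodule)
    (h_disj : Disjoint 𝔪₁.toSubmodule 𝔪₀.toSubmodule)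
    (h_ideal : ∀ x ∈ 𝔪₂, ∀ y ∈ 𝔪₁, ⁅x, y⁆ ∈ 𝔪₁)
    (hχ : ∀ y ∈ 𝔪₁, FiniteW.chi B f₂ y = FiniteW.chi B f₁ y)
    (hχ₂ : ∀ x ∈ 𝔪₂, ∀ y ∈ 𝔪₂, FiniteW.chi B f₂ ⁅x, y⁆ = 0) :
    ∃ j : 𝔪₀ →ₗ⁅ℂ⁆ FiniteW.WAlgebra B f₁ 𝔪₁,
      (∀ y : 𝔪₀, (j y : FiniteW.GelfandGraev B f₁ 𝔪₁)
        = FiniteW.toGG B f₁ 𝔪₁ (UniversalEnvelopingAlgebra.ι ℂ (y : 𝔤))) ∧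
      Function.Injective j ∧
      ∃ Ψ : QuantumReduction.invariants j (FiniteW.chiOn B f₂ 𝔪₀)
          ≃ₐ[ℂ] FiniteW.WAlgebra B f₂ 𝔪₂,
        ∀ (X : UniversalEnvelopingAlgebra ℂ 𝔤)
          (hX : FiniteW.toGG B f₁ 𝔪₁ X ∈ FiniteW.WAlgebra B f₁ 𝔪₁)
          (hX₀ : QuantumReduction.toQ j (FiniteW.chiOn B f₂ 𝔪₀) ⟨FiniteW.toGG B f₁ 𝔪₁ X, hX⟩
            ∈ QuantumReduction.invariants j (FiniteW.chiOn B f₂ 𝔪₀)),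
          (Ψ ⟨QuantumReduction.toQ j (FiniteW.chiOn B f₂ 𝔪₀)
              ⟨FiniteW.toGG B f₁ 𝔪₁ X, hX⟩, hX₀⟩ : FiniteW.GelfandGraev B f₂ 𝔪₂)
            = FiniteW.toGG B f₂ 𝔪₂ X := by
  have hle₁ : 𝔪₁ ≤ 𝔪₂ := (h_sup ▸ le_sup_left : 𝔪₁.toSubmodule ≤ 𝔪₂.toSubmodule)
  have hle₀ : 𝔪₀ ≤ 𝔪₂ := (h_sup ▸ le_sup_right : 𝔪₀.toSubmodule ≤ 𝔪₂.toSubmodule)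
  have h_lie : ∀ y : 𝔪₀, ∀ z ∈ 𝔪₁, ⁅z, (y : 𝔤)⁆ ∈ 𝔪₁ := fun y z hz => by
    rw [← lie_skew]
    exact neg_mem (h_ideal y (hle₀ y.2) z hz)
  have h_mem (y : 𝔪₀) := FiniteW.toGG_ι_mem_WAlgebra (h_lie y) fun z hz =>
    (hχ _ (h_lie y z hz)).symm.trans (hχ₂ z (hle₁ hz) y (hle₀ y.2))
  have h_stages := FiniteW.isStages_lieToWAlgebra hle₁ hle₀ h_sup.le hχ h_mem
  obtain ⟨E, hE⟩ := h𝔪₁.exists_isEuler hΓ₁ hq₁ hB_inv hB_nondeg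
  exact ⟨FiniteW.lieToWAlgebra h_mem, fun _ => rfl,
    FiniteW.lieToWAlgebra_injective V
      (fun _ hx _ hy => h𝔪₁.chi_lie hΓ₁ hq₁ hB_inv hx hy) h_disj h_mem,
    AlgEquiv.ofBijective _ (h_stages.comparison_bijective hE),
    fun _ _ hX₀ => h_stages.coe_comparison hX₀⟩

theorem theorem3p6 {𝔤 : Type*} [LieRing 𝔤] [LieAlgebra ℂ 𝔤] [FiniteDimensional ℂ 𝔤]
    [LieAlgebra.IsSimple ℂ 𝔤]
    (B : LinearMap.BilinForm ℂ 𝔤) (hB_symm : B.IsSymm) (hB_nondeg : B.Nondegenerate)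
    (hB_inv : B.lieInvariant 𝔤)
    (f₁ f₂ : 𝔤) (hf₁ : IsNilpotent (LieAlgebra.ad ℂ 𝔤 f₁))
    (hf₂ : IsNilpotent (LieAlgebra.ad ℂ 𝔤 f₂))
    (Γ₁ Γ₂ : ℤ → Submodule ℂ 𝔤)
    (hΓ₁ : FiniteW.IsGoodGrading Γ₁ f₁) (hΓ₂ : FiniteW.IsGoodGrading Γ₂ f₂)
    (q₁ q₂ : 𝔤) (hq₁ : FiniteW.IsGradingElement Γ₁ q₁) (hq₂ : FiniteW.IsGradingElement Γ₂ q₂)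
    (𝔥 : LieSubalgebra ℂ 𝔤) (h𝔥 : 𝔥.IsCartanSubalgebra) (hq₁𝔥 : q₁ ∈ 𝔥) (hq₂𝔥 : q₂ ∈ 𝔥)
    (𝔪₁ 𝔪₂ 𝔪₀ : LieSubalgebra ℂ 𝔤)
    (h𝔪₁ : FiniteW.IsGoodAlgebra B Γ₁ f₁ 𝔪₁) (h𝔪₂ : FiniteW.IsGoodAlgebra B Γ₂ f₂ 𝔪₂)
    -- `𝔪₂ = 𝔪₁ ⊕ 𝔪₀`, with `𝔪₀` stable under `𝔥` and `𝔪₁` an ideal of `𝔪₂`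
    (h_sup : 𝔪₂.toSubmodule = 𝔪₁.toSubmodule ⊔ 𝔪₀.toSubmodule)
    (h_disj : Disjoint 𝔪₁.toSubmodule 𝔪₀.toSubmodule)
    (h𝔪₀ : ∀ x ∈ 𝔥, ∀ y ∈ 𝔪₀, ⁅x, y⁆ ∈ 𝔪₀)
    (h_ideal : ∀ x ∈ 𝔪₂, ∀ y ∈ 𝔪₁, ⁅x, y⁆ ∈ 𝔪₁)
    (hf₀ : f₂ - f₁ ∈ Γ₁ 0) (h𝔪₀Γ : ∀ y ∈ 𝔪₀, y ∈ Γ₁ 0)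
    (hq₀ : ⁅q₂ - q₁, f₁⁆ = 0) :
    -- `y ↦ y mod Î₁` is an embedding `j` of Lie algebras of `𝔪₀` into `U(𝔤, f₁)`
    ∃ j : 𝔪₀ →ₗ⁅ℂ⁆ FiniteW.WAlgebra B f₁ 𝔪₁,
      (∀ y : 𝔪₀, (j y : FiniteW.GelfandGraev B f₁ 𝔪₁)
        = FiniteW.toGG B f₁ 𝔪₁ (UniversalEnvelopingAlgebra.ι ℂ (y : 𝔤))) ∧
      Function.Injective j ∧
      -- `(U(𝔤, f₁) / Î₀)^{ad 𝔪₀} → U(𝔤, f₂)`, `(X mod Î₁) mod Î₀ ↦ X mod Î₂`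
      ∃ Ψ : QuantumReduction.invariants j (FiniteW.chiOn B f₂ 𝔪₀)
          ≃ₐ[ℂ] FiniteW.WAlgebra B f₂ 𝔪₂,
        ∀ (X : UniversalEnvelopingAlgebra ℂ 𝔤)
          (hX : FiniteW.toGG B f₁ 𝔪₁ X ∈ FiniteW.WAlgebra B f₁ 𝔪₁)
          (hX₀ : QuantumReduction.toQ j (FiniteW.chiOn B f₂ 𝔪₀) ⟨FiniteW.toGG B f₁ 𝔪₁ X, hX⟩
            ∈ QuantumReduction.invariants j (FiniteW.chiOn B f₂ 𝔪₀)),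
          (Ψ ⟨QuantumReduction.toQ j (FiniteW.chiOn B f₂ 𝔪₀)
              ⟨FiniteW.toGG B f₁ 𝔪₁ X, hX⟩, hX₀⟩ : FiniteW.GelfandGraev B f₂ 𝔪₂)
            = FiniteW.toGG B f₂ 𝔪₂ X := by
  exact theorem3p6_general 𝔤 B hB_nondeg hB_inv f₁ f₂ Γ₁ hΓ₁ q₁ hq₁ 𝔪₁ 𝔪₂ 𝔪₀ h𝔪₁ h_sup
    h_disj h_ideal (fun _ hy => h𝔪₁.chi_eq_of_sub_mem hq₁ hB_inv hf₀ hy)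
    fun _ hx _ hy => h𝔪₂.chi_lie hΓ₂ hq₂ hB_inv hx hy
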